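/- **Theorem (Almost linear convergence rate, generalized MaxEnt).** Throughout, $\log$ is the logarithm to base $2$, $\ln$ the natural one, and $\|\cdot\|_2$ the Euclidean norm. Let $K\subset\mathbb R$ be compact, let $\mathcal P(K)$ be the set of Borel probability measures on $K$, let $\nu\in\mathcal P(K)$, $y\in\mathbb R^M$, and let $U_1,\dots,U_M\subset\mathbb R$ be compact convex sets containing $0$. Put $T:=\prod_{i=1}^M\{y_i-u : u\in U_i\}\subset\mathbb R^M$, and $(\mathcal A\mu)_i:=\int_K x^i\,\mu(dx)$ for $i=1,\dots,M$ and a finite signed measure $\mu$ on $K$, with norm $\|\mathcal A\|:=\sup\{\langle\mathcal A\mu,v\rangle : \|\mu\|_{\mathrm{TV}}=1,\ \|v\|_2=1\}$ (where $\|\mu\|_{\mathrm{TV}}=|\mu|(K)$), and $\mathcal A^*z(x):=\sum_{i=1}^M z_ix^i$. Let $D(\mu\|\nu):=\int\log\frac{d\mu}{d\nu}\,d\mu$ if $\mu\ll\nu$ and $+\infty$ otherwise, and $$J^\star:=\min_{\mu\in\mathcal P(K)}\{D(\mu\|\nu) : \mathcal A\mu\in T\},\qquad F(z):=-\max_{x\in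 T}\langle x,z\rangle+\min_{\mu\in\mathcal P(K)}\{D(\mu\|\nu)+\langle\mathcal A\mu,z\rangle\}\quad(z\in\mathbb R^M).$$ For $\eta=(\eta_1,\eta_2)\in\mathbb R_{>0}^2$ let $$F_\eta(z):=-\max_{x\in T}\Big\{\langle x,z\rangle-\tfrac{\eta_1}{2}\|x\|_2^2\Big\}+\min_{\mu\in\mathcal P(K)}\{D(\mu\|\nu)+\langle\mathcal A\mu,z\rangle\}-\tfrac{\eta_2}{2}\|z\|_2^2,\qquad L(\eta):=\tfrac1{\eta_1}+\|\mathcal A\|^2+\eta_2 ,$$ and consider the fast gradient method started at $w_0=y_0\in\mathbb R^M$: for $k\ge 0$, $$y_{k+1}=w_k+\tfrac1{L(\eta)}\nabla F_\eta(w_k),\qquad w_{k+1}=y_{k+1}+\tfrac{\sqrt{L(\eta)}-\sqrt{\eta_2}}{\sqrt{L(\eta)}+\sqrt{\eta_2}}\,(y_{k+1}-y_k).$$ Assume that there is a Slater point: $\mu_0\in\mathcal P(K)$ with $\mathcal A\mu_0\in T$, $\delta:=\inf_{x\in T^c}\|\mathcal A\mu_0-x\|_2>0$ and $0<C:=D(\mu_0\|\nu)<\infty$.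 Put $D:=\frac12\max_{x\in T}\|x\|_2^2$ and, for $\varepsilon>0$, $\eta_1(\varepsilon):=\frac{\varepsilon}{4D}$, $\eta_2(\varepsilon):=\frac{\varepsilon\delta^2}{2C^2}$, $\kappa(\varepsilon):=\frac{8DC^2}{\varepsilon^2\delta^2}+\frac{2\|\mathcal A\|^2C^2}{\varepsilon\delta^2}+1$, $$N_1(\varepsilon):=2\sqrt{\kappa(\varepsilon)}\,\ln\frac{10(\varepsilon+2C)}{\varepsilon},\qquad N_2(\varepsilon):=2\sqrt{\kappa(\varepsilon)}\,\ln\left(\frac{C}{\varepsilon\delta(2-\sqrt3)}\sqrt{4\Big(\frac{4D}{\varepsilon}+\|\mathcal A\|^2+\frac{\varepsilon\delta^2}{2C^2}\Big)\Big(C+\frac\varepsilon2\Big)}\right),$$ and $N(\varepsilon):=\lceil\max\{N_1(\varepsilon),N_2(\varepsilon)\}\rceil$. Then for every $\varepsilon>0$, with $\eta=(\eta_1(\varepsilon),\eta_2(\varepsilon))$ and any starting point $y_0$ with $F_\eta(y_0)\ge F_\eta(0)$ (for instance $y_0=0$), the iterate $\hat z:=y_{N(\varepsilon)}$ obtained after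 $N(\varepsilon)$ iterations and the probability measure $\hat\mu(B):=\int_B2^{-\mathcal A^*\hat z(x)}\nu(dx)\big/\int_K2^{-\mathcal A^*\hat z(x)}\nu(dx)$ satisfy $D(\hat\mu\|\nu)<\infty$ and * dual $\varepsilon$-optimality: $0\le J^\star-F(\hat z)\le\varepsilon$; * primal $\varepsilon$-optimality: $|D(\hat\mu\|\nu)-J^\star|\le 2(1+2\sqrt3)\,\varepsilon$; * primal $\varepsilon$-feasibility: $d(\mathcal A\hat\mu,T):=\min_{x\in T}\|\mathcal A\hat\mu-x\|_2\le\frac{2\varepsilon\delta}{C}$. Moreover, $N(\varepsilon)=O\big(\varepsilon^{-1}\log(1/\varepsilon)\big)$ as $\varepsilon\downarrow0$, all other data being fixed. -/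

import Mathlib

open MeasureTheory Filter Topology Asymptotics
open scoped ENNReal

namespace MaxEnt

noncomputable section

/-- Relative entropy in bits (logarithm to base `2`), with value `∞` unless `μ ≪ ν`. Mathlib's
`klDiv` is the natural-logarithm version. -/
def relEnt {α : Type*} [MeasurableSpace α] (μ ν : Measure α) : ℝ≥0∞ :=
  InformationTheory.klDiv μ ν / ENNReal.ofReal (Real.log 2)

variable {K : Set ℝ} {M : ℕ}

/-- The moment operator `(𝒜 μ)_i = ∫ x ^ i dμ`, `i = 1, …, M`, on (positive) measures on `K`. -/
def moments (M : ℕ) (μ : Measure K) : EuclideanSpace ℝ (Fin M) :=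
  WithLp.toLp 2 fun i => ∫ x : K, (x : ℝ) ^ ((i : ℕ) + 1) ∂μ

/-- The moment operator on finite signed measures, through the Jordan decomposition. -/
def signedMoments (M : ℕ) (s : SignedMeasure K) : EuclideanSpace ℝ (Fin M) :=
  moments M s.toJordanDecomposition.posPart - moments M s.toJordanDecomposition.negPart

/-- The operator norm of `𝒜` with respect to the total variation norm (total mass of the
variation) on signed measures and the Euclidean norm. -/
def momentNorm (K : Set ℝ) (M : ℕ) : ℝ :=
  sSup {r : ℝ | ∃ (s : SignedMeasure K) (v : EuclideanSpace ℝ (Fin M)),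
    s.totalVariation Set.univ = 1 ∧ ‖v‖ = 1 ∧ r = inner ℝ (signedMoments M s) v}

/-- The adjoint operator `(𝒜* z)(x) = ∑ z_i x ^ i`, `i = 1, …, M`. -/
def adjointMoments (z : EuclideanSpace ℝ (Fin M)) (x : ℝ) : ℝ :=
  ∑ i : Fin M, z i * x ^ ((i : ℕ) + 1)

/-- The set `T = ∏ {y_i - u : u ∈ U_i}`. -/
def constraintSet (y : Fin M → ℝ) (U : Fin M → Set ℝ) : Set (EuclideanSpace ℝ (Fin M)) :=
  {t | ∀ i, ∃ u ∈ U i, t i = y i - u}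

/-- The optimal value `J*` of the relative entropy minimization over `P(K)` subject to
`𝒜 μ ∈ T`. -/
def primalValue (ν : ProbabilityMeasure K) (T : Set (EuclideanSpace ℝ (Fin M))) : ℝ≥0∞ :=
  ⨅ μ : ProbabilityMeasure K, ⨅ _ : moments M (μ : Measure K) ∈ T, relEnt (μ : Measure K) ν

/-- The value `min_{μ ∈ P(K)} {D(μ‖ν) + ⟨𝒜 μ, z⟩}`. The infimum is taken in the extended reals,
where it is finite for compact `K`. -/
def entropyTerm (ν : ProbabilityMeasure K) (z : EuclideanSpace ℝ (Fin M)) : ℝ :=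
  (⨅ μ : ProbabilityMeasure K, ((relEnt (μ : Measure K) ν : ℝ≥0∞) : EReal) +
    ((inner ℝ (moments M (μ : Measure K)) z : ℝ) : EReal)).toReal

/-- The support function of `T`. -/
def supportFn (T : Set (EuclideanSpace ℝ (Fin M))) (z : EuclideanSpace ℝ (Fin M)) : ℝ :=
  sSup ((fun x => inner ℝ x z) '' T)

/-- The dual function `F`. -/
def dualFn (ν : ProbabilityMeasure K) (T : Set (EuclideanSpace ℝ (Fin M)))
    (z : EuclideanSpace ℝ (Fin M)) : ℝ :=
  -supportFn T z + entropyTerm ν z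

/-- The doubly smoothed dual function `F_η`, `η = (η₁, η₂)`. -/
def smoothedDualFn (ν : ProbabilityMeasure K) (T : Set (EuclideanSpace ℝ (Fin M))) (η₁ η₂ : ℝ)
    (z : EuclideanSpace ℝ (Fin M)) : ℝ :=
  -sSup ((fun x => inner ℝ x z - η₁ / 2 * ‖x‖ ^ 2) '' T) + entropyTerm ν z - η₂ / 2 * ‖z‖ ^ 2

/-- The constant `L(η) = 1 / η₁ + ‖𝒜‖² + η₂`. -/
def lipConst (K : Set ℝ) (M : ℕ) (η₁ η₂ : ℝ) : ℝ :=
  1 / η₁ + momentNorm K M ^ 2 + η₂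

/-- The pair `(y_k, w_k)` after `k` iterations of the fast gradient method for maximizing
`F_η`, started at `y₀ = w₀`. -/
def fastGradient (ν : ProbabilityMeasure K) (T : Set (EuclideanSpace ℝ (Fin M))) (η₁ η₂ : ℝ)
    (y₀ : EuclideanSpace ℝ (Fin M)) :
    ℕ → EuclideanSpace ℝ (Fin M) × EuclideanSpace ℝ (Fin M)
  | 0 => (y₀, y₀)
  | k + 1 =>
    let L := lipConst K M η₁ η₂
    let y := (fastGradient ν T η₁ η₂ y₀ k).1
    let w := (fastGradient ν T η₁ η₂ y₀ k).2
    let y' := w + (1 / L) • gradient (smoothedDualFn ν T η₁ η₂) w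
    (y', y' + ((√L - √η₂) / (√L + √η₂)) • (y' - y))

/-- The Gibbs measure with density proportional to `2 ^ (-(𝒜* z)(x))` with respect to `ν`. -/
def gibbs (ν : ProbabilityMeasure K) (z : EuclideanSpace ℝ (Fin M)) : Measure K :=
  (∫⁻ x : K, ENNReal.ofReal ((2 : ℝ) ^ (-adjointMoments z x)) ∂(ν : Measure K))⁻¹ •
    (ν : Measure K).withDensity fun x => ENNReal.ofReal ((2 : ℝ) ^ (-adjointMoments z x))

/-- The constant `C = D(μ₀‖ν)`. -/
def constC (ν μ₀ : ProbabilityMeasure K) : ℝ :=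
  (relEnt (μ₀ : Measure K) ν).toReal

/-- The constant `D = (1 / 2) max_{x ∈ T} ‖x‖²`. -/
def constD (T : Set (EuclideanSpace ℝ (Fin M))) : ℝ :=
  1 / 2 * sSup ((fun x => ‖x‖ ^ 2) '' T)

/-- The distance `δ` of `𝒜 μ₀` to the complement of `T`. -/
def constδ (T : Set (EuclideanSpace ℝ (Fin M))) (μ₀ : ProbabilityMeasure K) : ℝ :=
  Metric.infDist (moments M (μ₀ : Measure K)) Tᶜ

/-- `N₁(ε)`, where `a` stands for `‖𝒜‖`. -/
def iter₁ (C D δ a ε : ℝ) : ℝ :=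
  2 * √(8 * D * C ^ 2 / (ε ^ 2 * δ ^ 2) + 2 * a ^ 2 * C ^ 2 / (ε * δ ^ 2) + 1) *
    Real.log (10 * (ε + 2 * C) / ε)

/-- `N₂(ε)`, where `a` stands for `‖𝒜‖`. -/
def iter₂ (C D δ a ε : ℝ) : ℝ :=
  2 * √(8 * D * C ^ 2 / (ε ^ 2 * δ ^ 2) + 2 * a ^ 2 * C ^ 2 / (ε * δ ^ 2) + 1) *
    Real.log (C / (ε * δ * (2 - √3)) *
      √(4 * (4 * D / ε + a ^ 2 + ε * δ ^ 2 / (2 * C ^ 2)) * (C + ε / 2)))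

/-- `N(ε) = ⌈max {N₁(ε), N₂(ε)}⌉`. -/
def numIter (C D δ a ε : ℝ) : ℕ :=
  ⌈max (iter₁ C D δ a ε) (iter₂ C D δ a ε)⌉₊

end

end MaxEnt

/-! The Gibbs variational principle evaluates the inner minimum (`entropyTerm_eq`): `F(z)` is minus
the support function of `T` minus the base-2 log-partition function, and the Gibbs measure attains
the minimum. The Slater point gives `F(z) ≤ C - δ‖z‖`, so `F` has a maximizer `p` with `‖p‖ ≤ C/δ`;
first-order optimality makes the Gibbs measure at `p` feasible with complementary slackness, which
is strong duality (`exists_dual_optimizer`).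

The parameters keep both smoothing errors small: regularizing the support function changes `F` by at
most `η₁D = ε/4`, and the quadratic penalty costs at most `η₂/2 · (C/δ)² = ε/4` at `p`. After
smoothing, `-F_η` has curvature between `η₂` and `L(η)`: the regularized support function
contributes `1/η₁`, the log-partition function `‖𝒜‖²` by Hoeffding's lemma, the penalty `η₂`
(`exists_smoothedDualFn_gradient`). Hence the fast gradient method shrinks the gap at rate `exp
(-k/√κ)` (`QuadBounds.fast_gradient_rate`); `N₁` brings it below `ε/100`, and `N₂` makes the
gradient small through `‖∇‖² ≤ 2L · gap` (`fastGradient_gap`).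

The gradient of `-F_η` at `z` is `q - 𝒜μ̂ + η₂z`, where `q ∈ T` nearly attains the support function.
The gap bounds `‖z‖` by `2C/δ`, so a small gradient puts `𝒜μ̂` near `q`, and pairing the gradient
with `z` compares `D(μ̂‖ν)` with `F(z)` (`accuracy_of_small_gap`). -/

namespace MaxEnt

/-! ### Smooth strongly convex functions and the fast gradient method. -/

section Optimization

variable {E : Type*} [NormedAddCommGroup E] [InnerProductSpace ℝ E]

/-- `g` is a gradient field of `f` with curvature between `m` and `L`. -/
def QuadBounds (f : E → ℝ) (g : E → E) (m L : ℝ) : Prop :=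
  ∀ x d, f x + inner ℝ (g x) d + m / 2 * ‖d‖ ^ 2 ≤ f (x + d) ∧
    f (x + d) ≤ f x + inner ℝ (g x) d + L / 2 * ‖d‖ ^ 2

theorem QuadBounds.add {f₁ f₂ : E → ℝ} {g₁ g₂ : E → E} {m₁ m₂ L₁ L₂ : ℝ}
    (h₁ : QuadBounds f₁ g₁ m₁ L₁) (h₂ : QuadBounds f₂ g₂ m₂ L₂) :
    QuadBounds (fun x => f₁ x + f₂ x) (fun x => g₁ x + g₂ x) (m₁ + m₂) (L₁ + L₂) := by
  intro x d
  have := h₁ x d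
  have := h₂ x d
  simp only [inner_add_left]
  constructor <;> linarith

theorem QuadBounds.neg {f : E → ℝ} {g : E → E} {m L : ℝ} (h : QuadBounds f g m L) :
    QuadBounds (fun x => -f x) (fun x => -g x) (-L) (-m) := by
  intro x d
  have := h x d
  simp only [inner_neg_left]
  constructor <;> linarith

theorem quadBounds_norm_sq (c : ℝ) :
    QuadBounds (fun x : E => c / 2 * ‖x‖ ^ 2) (fun x => c • x) c c := by
  intro x d
  simp only [norm_add_sq_real, inner_smul_left, conj_trivial]
  constructor <;> linarith

/-- The two quadratic bounds force a remainder of order `‖d‖ ^ 2`. This identifies the `gradient`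
used by the algorithm with an explicit field. -/
theorem QuadBounds.hasGradientAt [CompleteSpace E] {f : E → ℝ} {g : E → E} {m L : ℝ}
    (h : QuadBounds f g m L) (x : E) : HasGradientAt f (g x) x := by
  rw [hasGradientAt_iff_isLittleO_nhds_zero]
  have hO : (fun d => f (x + d) - f x - inner ℝ (g x) d) =O[𝓝 0] fun d : E => ‖d‖ ^ 2 := by
    refine IsBigO.of_bound (|m / 2| + |L / 2|) (Eventually.of_forall fun d => ?_)
    have hd := h x d
    have h1 := mul_le_mul_of_nonneg_right (neg_abs_le (m / 2)) (sq_nonneg ‖d‖)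
    have h2 := mul_le_mul_of_nonneg_right (le_abs_self (L / 2)) (sq_nonneg ‖d‖)
    have h3 := mul_nonneg (abs_nonneg (m / 2)) (sq_nonneg ‖d‖)
    have h4 := mul_nonneg (abs_nonneg (L / 2)) (sq_nonneg ‖d‖)
    rw [Real.norm_eq_abs, norm_pow, norm_norm, abs_le]
    constructor <;> linarith
  exact hO.trans_isLittleO (isLittleO_norm_pow_id one_lt_two)

theorem QuadBounds.continuous [CompleteSpace E] {f : E → ℝ} {g : E → E} {m L : ℝ}
    (h : QuadBounds f g m L) : Continuous f :=
  continuous_iff_continuousAt.2 fun x => (h.hasGradientAt x).hasFDerivAt.continuousAt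

/-- The step `-(1 / L) • g x` minimizes the upper quadratic model at `x`. -/
theorem QuadBounds.apply_sub_le {f : E → ℝ} {g : E → E} {m L : ℝ}
    (h : QuadBounds f g m L) (hL : 0 < L) (x : E) :
    f (x - (1 / L) • g x) ≤ f x - ‖g x‖ ^ 2 / (2 * L) := by
  have := (h x (-((1 / L) • g x))).2
  rw [← sub_eq_add_neg, inner_neg_right, inner_smul_right, norm_neg, norm_smul,
    real_inner_self_eq_norm_sq, mul_pow, Real.norm_eq_abs, sq_abs] at this
  refine this.trans (le_of_eq ?_)
  field_simp
  ring

theorem QuadBounds.norm_sq_le {f : E → ℝ} {g : E → E} {m L : ℝ}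
    (h : QuadBounds f g m L) (hL : 0 < L) {p : E} (hp : ∀ x, f p ≤ f x) (x : E) :
    ‖g x‖ ^ 2 ≤ 2 * L * (f x - f p) := by
  have h1 := h.apply_sub_le hL x
  have h2 := hp (x - (1 / L) • g x)
  have h3 : ‖g x‖ ^ 2 / (2 * L) ≤ f x - f p := by linarith
  rwa [div_le_iff₀ (by positivity), mul_comm] at h3

theorem QuadBounds.dist_sq_le [CompleteSpace E] {f : E → ℝ} {g : E → E} {m L : ℝ}
    (h : QuadBounds f g m L) {p : E} (hp : ∀ x, f p ≤ f x) (x : E) :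
    m / 2 * ‖x - p‖ ^ 2 ≤ f x - f p := by
  have h0 : g p = 0 := by
    have h1 := (h.hasGradientAt p).hasFDerivAt
    have h2 : IsLocalMin f p := Eventually.of_forall hp
    have := h2.hasFDerivAt_eq_zero h1
    simpa using this
  have := (h p (x - p)).1
  rw [h0, inner_zero_left, add_sub_cancel] at this
  linarith

theorem norm_sq_combo_le {s : ℝ} (hs0 : 0 ≤ s) (hs1 : s ≤ 1) (a b : E) :
    ‖(1 - s) • a + s • b‖ ^ 2 ≤ (1 - s) * ‖a‖ ^ 2 + s * ‖b‖ ^ 2 := by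
  have h := sq_nonneg ‖a - b‖
  rw [norm_sub_sq_real] at h
  rw [norm_add_sq_real, norm_smul, norm_smul, inner_smul_left, inner_smul_right, mul_pow, mul_pow,
    Real.norm_eq_abs, Real.norm_eq_abs, sq_abs, sq_abs]
  simp only [conj_trivial]
  nlinarith [mul_nonneg hs0 (sub_nonneg.2 hs1)]

/-- One step of the fast gradient method contracts the potential
`f y - f x + m / 2 * ‖v - x‖ ^ 2` by the factor `1 - √(m / L)`. -/
theorem QuadBounds.potential_step {f : E → ℝ} {g : E → E} {m L s : ℝ}
    (h : QuadBounds f g m L) (hm : 0 < m) (hL : 0 < L) (hs0 : 0 < s) (hs1 : s ≤ 1)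
    (hs : s ^ 2 * L = m) (x y v w : E) (hw : (1 + s) • w = y + s • v) :
    f (w - (1 / L) • g w) - f x +
        m / 2 * ‖(1 - s) • v + s • w - (s / m) • g w - x‖ ^ 2 ≤
      (1 - s) * (f y - f x + m / 2 * ‖v - x‖ ^ 2) := by
  have h1 := h.apply_sub_le hL w
  have h2 := (h w (x - w)).1
  have h3 := (h w (y - w)).1
  rw [add_sub_cancel] at h2 h3
  have h4 := norm_sq_combo_le hs0.le hs1 (v - x) (w - x)
  set c := (1 - s) • (v - x) + s • (w - x) with hc
  have e1 : (1 - s) • v + s • w - (s / m) • g w - x = c - (s / m) • g w := by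
    rw [hc]; module
  have e2 : ‖(1 - s) • v + s • w - (s / m) • g w - x‖ ^ 2 =
      ‖c‖ ^ 2 - 2 * (s / m) * inner ℝ (g w) c + (s / m) ^ 2 * ‖g w‖ ^ 2 := by
    rw [e1, norm_sub_sq_real, inner_smul_right, norm_smul, mul_pow, Real.norm_eq_abs, sq_abs,
      real_inner_comm]
    ring
  -- Eliminating `v` by `hw` turns the cross term into the linear terms of the lower bounds towards
  -- `x` and `y`, with weights `s` and `1 - s`.
  have e3 : s * inner ℝ (g w) c =
      -(s * inner ℝ (g w) (x - w)) - (1 - s) * inner ℝ (g w) (y - w) := by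
    have : y = (1 + s) • w - s • v := by rw [hw]; abel
    rw [this, hc]
    simp only [inner_add_right, inner_sub_right, inner_smul_right]
    ring
  -- Because `s ^ 2 * L = m`, this term cancels exactly against the decrease `h1` of the gradient
  -- step.
  have e4 : m / 2 * ((s / m) ^ 2 * ‖g w‖ ^ 2) = ‖g w‖ ^ 2 / (2 * L) := by
    rw [← hs]; field_simp
  have e5 : m / 2 * (2 * (s / m) * inner ℝ (g w) c) = s * inner ℝ (g w) c := by
    field_simp
  have e6 : ‖x - w‖ = ‖w - x‖ := norm_sub_rev _ _
  rw [e2]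
  rw [e6] at h2
  have h5 : 0 ≤ m / 2 * ‖y - w‖ ^ 2 := by positivity
  have h6 := mul_le_mul_of_nonneg_left h2 hs0.le
  have h7 : (1 - s) * (f w + inner ℝ (g w) (y - w)) ≤ (1 - s) * f y :=
    mul_le_mul_of_nonneg_left (by linarith) (sub_nonneg.2 hs1)
  have h8 := mul_le_mul_of_nonneg_left h4 (half_pos hm).le
  nlinarith

/-- Linear convergence of the constant step fast gradient method. -/
theorem QuadBounds.fast_gradient_rate [CompleteSpace E] {f : E → ℝ} {g : E → E} {m L : ℝ}
    (h : QuadBounds f g m L) (hm : 0 < m) (hmL : m ≤ L) {p : E} (hp : ∀ x, f p ≤ f x)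
    (y w : ℕ → E) (h0 : w 0 = y 0) (hy : ∀ k, y (k + 1) = w k - (1 / L) • g (w k))
    (hw : ∀ k, w (k + 1) = y (k + 1) + ((√L - √m) / (√L + √m)) • (y (k + 1) - y k)) (k : ℕ) :
    f (y k) - f p ≤ 2 * (f (y 0) - f p) * Real.exp (-(k / √(L / m))) := by
  have hL : 0 < L := hm.trans_le hmL
  set s := √m / √L with hsdef
  have hsm : 0 < √m := Real.sqrt_pos.2 hm
  have hsL : 0 < √L := Real.sqrt_pos.2 hL
  have hs0 : 0 < s := div_pos hsm hsL
  have hs1 : s ≤ 1 := (div_le_one hsL).2 (Real.sqrt_le_sqrt hmL)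
  have hs : s ^ 2 * L = m := by
    rw [hsdef, div_pow, Real.sq_sqrt hm.le, Real.sq_sqrt hL.le]; field_simp
  have hβ : (√L - √m) / (√L + √m) = (1 - s) / (1 + s) := by
    rw [hsdef]; field_simp
  have hκ : 1 / √(L / m) = s := by rw [Real.sqrt_div hL.le, one_div_div]
  -- The momentum hides this estimate sequence: `w k` is the mean of `y k` and `v k` with weights
  -- proportional to `1` and `s`, and `v 0 = y 0`.
  let v : ℕ → E := fun k => w k + (1 / s) • (w k - y k)
  have hwv : ∀ k, (1 + s) • w k = y k + s • v k := fun k => by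
    simp only [v, smul_add, smul_smul, mul_one_div_cancel hs0.ne']; module
  have hv : ∀ k, v (k + 1) = (1 - s) • v k + s • w k - (s / m) • g (w k) := fun k => by
    have e1 : v (k + 1) = y k + (1 / s) • (y (k + 1) - y k) := by
      simp only [v]
      rw [hw k, hβ]
      have : (1 - s) / (1 + s) + 1 / s * ((1 - s) / (1 + s)) = 1 / s - 1 := by
        field_simp
        ring
      calc _ = y (k + 1) + ((1 - s) / (1 + s) + 1 / s * ((1 - s) / (1 + s))) •
            (y (k + 1) - y k) := by module
        _ = _ := by rw [this]; module
    have e2 : y k = (1 + s) • w k - s • v k := by rw [hwv]; abel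
    have e3 : (1 / s) * (1 / L) = s / m := by rw [← hs]; field_simp
    rw [e1, hy k, e2, ← e3]
    have e4 : (1 / s) * s = 1 := by field_simp
    have e5 : (1 / s) • (w k - (1 / L) • g (w k) - ((1 + s) • w k - s • v k)) =
        -((1 / s * s) • w k) + (1 / s * s) • v k - (1 / s * (1 / L)) • g (w k) := by module
    rw [e5, e4]
    module
  have hΦ : ∀ k, f (y k) - f p + m / 2 * ‖v k - p‖ ^ 2 ≤
      (1 - s) ^ k * (f (y 0) - f p + m / 2 * ‖y 0 - p‖ ^ 2) := by
    intro k
    induction k with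
    | zero => simp [v, h0]
    | succ k ih =>
      have := h.potential_step hm hL hs0 hs1 hs p (y k) (v k) (w k) (hwv k)
      rw [← hy k, ← hv k] at this
      refine this.trans ?_
      rw [pow_succ' (1 - s), mul_assoc]
      exact mul_le_mul_of_nonneg_left ih (sub_nonneg.2 hs1)
  have h1 := hΦ k
  -- Strong convexity absorbs the distance part of the initial potential into the gap, whence the
  -- factor `2` in the rate.
  have h2 := h.dist_sq_le hp (y 0)
  have h3 : 0 ≤ m / 2 * ‖v k - p‖ ^ 2 := by positivity
  have h4 : (1 - s) ^ k ≤ Real.exp (-(k / √(L / m))) := by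
    calc (1 - s) ^ k ≤ Real.exp (-s) ^ k :=
          pow_le_pow_left₀ (sub_nonneg.2 hs1) (Real.one_sub_le_exp_neg s) k
      _ = _ := by rw [← Real.exp_nat_mul, ← hκ]; ring_nf
  have h5 : 0 ≤ f (y 0) - f p := sub_nonneg.2 (hp _)
  calc f (y k) - f p ≤ (1 - s) ^ k * (f (y 0) - f p + m / 2 * ‖y 0 - p‖ ^ 2) := by linarith
    _ ≤ (1 - s) ^ k * (2 * (f (y 0) - f p)) :=
        mul_le_mul_of_nonneg_left (by linarith) (pow_nonneg (sub_nonneg.2 hs1) k)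
    _ ≤ Real.exp (-(k / √(L / m))) * (2 * (f (y 0) - f p)) :=
        mul_le_mul_of_nonneg_right h4 (by linarith)
    _ = _ := by ring

end Optimization

theorem exists_forall_le_of_coercive {E : Type*} [NormedAddCommGroup E] [ProperSpace E] {f : E → ℝ}
    (hf : Continuous f) {b c : ℝ} (hc : 0 < c) (h : ∀ x, c * ‖x‖ - b ≤ f x) :
    ∃ p, ∀ x, f p ≤ f x := by
  refine hf.exists_forall_le (tendsto_atTop_mono h ?_)
  exact tendsto_atTop_add_const_right _ _ (tendsto_norm_cocompact_atTop.const_mul_atTop hc)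

/-- Let `t` tend to `0`. This extracts first-order conditions: `t * B` is a second-order error
already divided by `t`. -/
theorem nonpos_of_forall_le_mul {A B : ℝ} (h : ∀ t : ℝ, 0 < t → t ≤ 1 → A ≤ t * B) : A ≤ 0 := by
  have h1 : Tendsto (fun t : ℝ => t * B) (𝓝[>] 0) (𝓝 0) := by
    have : Tendsto (fun t : ℝ => t * B) (𝓝 0) (𝓝 (0 * B)) := tendsto_id.mul_const B
    rw [zero_mul] at this
    exact this.mono_left nhdsWithin_le_nhds
  refine ge_of_tendsto h1 ?_
  filter_upwards [Ioc_mem_nhdsGT (zero_lt_one' ℝ)] with t ht using h t ht.1 ht.2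

/-! ### Regularized support functions. -/

section Support

variable {E : Type*} [NormedAddCommGroup E] [InnerProductSpace ℝ E] {T : Set E}

theorem exists_regularized_max (hT : IsCompact T) (hne : T.Nonempty) (η : ℝ) (z : E) :
    ∃ p ∈ T, sSup ((fun x => inner ℝ x z - η / 2 * ‖x‖ ^ 2) '' T) =
        inner ℝ p z - η / 2 * ‖p‖ ^ 2 ∧
      ∀ x ∈ T, inner ℝ x z - η / 2 * ‖x‖ ^ 2 ≤ inner ℝ p z - η / 2 * ‖p‖ ^ 2 := by
  obtain ⟨p, hp, h1, h2⟩ := hT.exists_sSup_image_eq_and_ge hne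
    (f := fun x => inner ℝ x z - η / 2 * ‖x‖ ^ 2) (by fun_prop)
  exact ⟨p, hp, h1, h2⟩

/-- The support function of a compact convex set, regularized by `η / 2 * ‖x‖ ^ 2`, is smooth,
its gradient being the maximizer. -/
theorem exists_regularized_support (hT : IsCompact T) (hconv : Convex ℝ T) (hne : T.Nonempty)
    {η : ℝ} (hη : 0 < η) :
    ∃ p : E → E, (∀ z, p z ∈ T) ∧
      (∀ z, sSup ((fun x => inner ℝ x z - η / 2 * ‖x‖ ^ 2) '' T) =
        inner ℝ (p z) z - η / 2 * ‖p z‖ ^ 2) ∧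
      QuadBounds (fun z => sSup ((fun x => inner ℝ x z - η / 2 * ‖x‖ ^ 2) '' T)) p 0 (1 / η) := by
  choose p hpT hpS hpmax using exists_regularized_max hT hne η
  refine ⟨p, hpT, hpS, fun z d => ?_⟩
  simp only [hpS]
  constructor
  -- The old maximizer competes at `z + d`.
  · have := hpmax (z + d) (p z) (hpT z)
    rw [inner_add_right] at this
    linarith
  · set x := p (z + d)
    set q := p z
    -- Variational inequality for the maximizer `q` over convex `T`, tested along the segment
    -- towards `x`.
    have hvar : inner ℝ (x - q) z - η * inner ℝ q (x - q) ≤ 0 := by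
      refine nonpos_of_forall_le_mul (B := η / 2 * ‖x - q‖ ^ 2) fun t ht0 ht1 => ?_
      have hmem : q + t • (x - q) ∈ T :=
        hconv.add_smul_sub_mem (hpT z) (hpT (z + d)) ⟨ht0.le, ht1⟩
      have := hpmax z _ hmem
      rw [norm_add_sq_real, inner_add_left, inner_smul_left, inner_smul_right, norm_smul,
        mul_pow, Real.norm_eq_abs, sq_abs] at this
      simp only [conj_trivial] at this
      refine le_of_mul_le_mul_left ?_ ht0
      linarith
    -- Completing the square bounds the remaining cross term by `‖d‖ ^ 2 / (2 * η)`.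
    have hsq : 0 ≤ ‖d - η • (x - q)‖ ^ 2 := sq_nonneg _
    rw [norm_sub_sq_real, inner_smul_right, norm_smul, mul_pow, Real.norm_eq_abs, sq_abs] at hsq
    have hx : x = q + (x - q) := by abel
    have e1 : ‖x‖ ^ 2 = ‖q‖ ^ 2 + 2 * inner ℝ q (x - q) + ‖x - q‖ ^ 2 := by
      rw [← norm_add_sq_real, ← hx]
    have e2 : inner ℝ x (z + d) = inner ℝ q z + inner ℝ (x - q) z + inner ℝ q d +
        inner ℝ d (x - q) := by
      rw [real_inner_comm (x - q) d]
      simp only [inner_add_right, inner_sub_left]; ring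
    rw [e1, e2]
    have h3 : inner ℝ d (x - q) - η / 2 * ‖x - q‖ ^ 2 ≤ 1 / η / 2 * ‖d‖ ^ 2 := by
      have : 1 / η / 2 * ‖d‖ ^ 2 - (inner ℝ d (x - q) - η / 2 * ‖x - q‖ ^ 2) =
        1 / (2 * η) * (‖d‖ ^ 2 - 2 * (η * inner ℝ d (x - q)) + η ^ 2 * ‖x - q‖ ^ 2) := by
        field_simp
        ring
      have h4 : 0 ≤ 1 / (2 * η) * (‖d‖ ^ 2 - 2 * (η * inner ℝ d (x - q)) +
        η ^ 2 * ‖x - q‖ ^ 2) := mul_nonneg (by positivity) hsq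
      linarith
    linarith

end Support

/-! ### The support function of `T` and the geometry of the constraint set. -/

section SupportFn

variable {M : ℕ} {T : Set (EuclideanSpace ℝ (Fin M))}

theorem exists_supportFn_eq (hT : IsCompact T) (hne : T.Nonempty) (z : EuclideanSpace ℝ (Fin M)) :
    ∃ p ∈ T, supportFn T z = inner ℝ p z ∧ ∀ x ∈ T, inner ℝ x z ≤ inner ℝ p z := by
  simpa [supportFn] using exists_regularized_max hT hne 0 z

theorem inner_le_supportFn (hT : IsCompact T) {x : EuclideanSpace ℝ (Fin M)} (hx : x ∈ T)
    (z : EuclideanSpace ℝ (Fin M)) : inner ℝ x z ≤ supportFn T z := by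
  obtain ⟨p, -, h1, h2⟩ := exists_supportFn_eq hT ⟨x, hx⟩ z
  exact h1 ▸ h2 x hx

theorem supportFn_add_smul_le (hT : IsCompact T) (hne : T.Nonempty)
    (z d : EuclideanSpace ℝ (Fin M)) {t : ℝ} (ht : 0 ≤ t) :
    supportFn T (z + t • d) ≤ supportFn T z + t * supportFn T d := by
  obtain ⟨p, hp, h1, -⟩ := exists_supportFn_eq hT hne (z + t • d)
  rw [h1, inner_add_right, inner_smul_right]
  exact add_le_add (inner_le_supportFn hT hp z)
    (mul_le_mul_of_nonneg_left (inner_le_supportFn hT hp d) ht)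

theorem supportFn_smul_le (hT : IsCompact T) (hne : T.Nonempty)
    (z : EuclideanSpace ℝ (Fin M)) {t : ℝ} (ht : 0 ≤ t) :
    supportFn T (t • z) ≤ t * supportFn T z := by
  obtain ⟨p, hp, h1, -⟩ := exists_supportFn_eq hT hne (t • z)
  rw [h1, inner_smul_right]
  exact mul_le_mul_of_nonneg_left (inner_le_supportFn hT hp z) ht

theorem continuous_supportFn (hT : IsCompact T) (hne : T.Nonempty) :
    Continuous (supportFn T) := by
  obtain ⟨R, hR⟩ := hT.isBounded.exists_norm_le
  have key : ∀ z w, supportFn T z ≤ supportFn T w + R * dist z w := fun z w => by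
    obtain ⟨p, hp, h1, -⟩ := exists_supportFn_eq hT hne z
    have h2 := inner_le_supportFn hT hp w
    have h3 : inner ℝ p (z - w) ≤ R * ‖z - w‖ :=
      (real_inner_le_norm _ _).trans (mul_le_mul_of_nonneg_right (hR p hp) (norm_nonneg _))
    rw [inner_sub_right] at h3
    rw [h1, dist_eq_norm]
    linarith
  have hR0 : 0 ≤ R := hne.elim fun x hx => (norm_nonneg x).trans (hR x hx)
  lift R to NNReal using hR0
  exact (LipschitzWith.of_le_add_mul R key).continuous

/-- From `p` one can move in the direction of `z` by any length below the distance to `Tᶜ` without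
leaving `T`. This is how the Slater margin enters. -/
theorem inner_add_mul_norm_le_supportFn (hT : IsCompact T) {p : EuclideanSpace ℝ (Fin M)}
    (hp : p ∈ T) (z : EuclideanSpace ℝ (Fin M)) :
    inner ℝ p z + Metric.infDist p Tᶜ * ‖z‖ ≤ supportFn T z := by
  rcases eq_or_ne z 0 with rfl | hz
  · simpa using inner_le_supportFn hT hp 0
  have hz' : 0 < ‖z‖ := norm_pos_iff.2 hz
  rw [← le_sub_iff_add_le', ← le_div_iff₀ hz']
  refine le_of_forall_lt_imp_le_of_dense fun r hr => ?_
  rcases lt_or_ge r 0 with hr0 | hr0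
  · exact hr0.le.trans (div_nonneg (sub_nonneg.2 (inner_le_supportFn hT hp z)) hz'.le)
  have hmem : p + (r / ‖z‖) • z ∈ T := by
    by_contra hx
    have h1 := Metric.infDist_le_dist_of_mem (x := p) (s := Tᶜ) hx
    rw [dist_self_add_right, norm_smul, norm_div, norm_norm, Real.norm_of_nonneg hr0,
      div_mul_cancel₀ _ hz'.ne'] at h1
    linarith
  have h2 := inner_le_supportFn hT hmem z
  rw [inner_add_left, inner_smul_left, real_inner_self_eq_norm_sq] at h2
  simp only [conj_trivial] at h2
  have h3 : r / ‖z‖ * ‖z‖ ^ 2 = r * ‖z‖ := by field_simp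
  rw [le_div_iff₀ hz']
  linarith

/-- Otherwise a separating functional, written as an inner product with some `d`, violates the
hypothesis. -/
theorem mem_of_forall_inner_le_supportFn (hT : IsCompact T) (hconv : Convex ℝ T)
    (hne : T.Nonempty) {p : EuclideanSpace ℝ (Fin M)}
    (h : ∀ d, inner ℝ p d ≤ supportFn T d) : p ∈ T := by
  by_contra hp
  obtain ⟨f, u, h1, h2⟩ := geometric_hahn_banach_closed_point hconv hT.isClosed hp
  set d := (InnerProductSpace.toDual ℝ (EuclideanSpace ℝ (Fin M))).symm f
  have hd : ∀ x, inner ℝ x d = f x := fun x => by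
    rw [real_inner_comm]; exact InnerProductSpace.toDual_symm_apply
  obtain ⟨q, hq, h3, -⟩ := exists_supportFn_eq hT hne d
  have := h d
  rw [h3, hd, hd] at this
  linarith [h1 q hq]

theorem norm_sq_le_constD (hT : IsCompact T) {x : EuclideanSpace ℝ (Fin M)} (hx : x ∈ T) :
    ‖x‖ ^ 2 ≤ 2 * constD T := by
  have : ‖x‖ ^ 2 ≤ sSup ((fun x => ‖x‖ ^ 2) '' T) :=
    le_csSup (hT.image (by fun_prop)).bddAbove ⟨x, hx, rfl⟩
  rw [constD]
  linarith

theorem supportFn_le_regularized_add (hT : IsCompact T) (hne : T.Nonempty) {η : ℝ} (hη : 0 ≤ η)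
    (z : EuclideanSpace ℝ (Fin M)) :
    supportFn T z ≤ sSup ((fun x => inner ℝ x z - η / 2 * ‖x‖ ^ 2) '' T) + η * constD T := by
  obtain ⟨p, hp, h1, -⟩ := exists_supportFn_eq hT hne z
  obtain ⟨q, hq, h2, h3⟩ := exists_regularized_max hT hne η z
  have h4 := h3 p hp
  have h5 := mul_le_mul_of_nonneg_left (norm_sq_le_constD hT hp) (div_nonneg hη zero_le_two)
  rw [h1, h2]
  linarith

theorem regularized_le_supportFn (hT : IsCompact T) (hne : T.Nonempty) {η : ℝ} (hη : 0 ≤ η)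
    (z : EuclideanSpace ℝ (Fin M)) :
    sSup ((fun x => inner ℝ x z - η / 2 * ‖x‖ ^ 2) '' T) ≤ supportFn T z := by
  obtain ⟨q, hq, h2, -⟩ := exists_regularized_max hT hne η z
  have h3 := inner_le_supportFn hT hq z
  have : 0 ≤ η / 2 * ‖q‖ ^ 2 := by positivity
  rw [h2]
  linarith

theorem constD_pos (hT : IsCompact T) {p : EuclideanSpace ℝ (Fin M)} (hp : p ∈ T)
    (hδ : 0 < Metric.infDist p Tᶜ) : 0 < constD T := by
  by_contra hD
  have h0 : ∀ x ∈ T, x = 0 := fun x hx => by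
    have := norm_sq_le_constD hT hx
    have : ‖x‖ ^ 2 = 0 := le_antisymm (by linarith) (sq_nonneg _)
    simpa using this
  -- In dimension zero `Tᶜ` is empty and `Metric.infDist` takes its default value `0`, against `hδ`.
  have hM : Nontrivial (EuclideanSpace ℝ (Fin M)) := by
    by_contra hM
    rw [not_nontrivial_iff_subsingleton] at hM
    have : Tᶜ = ∅ := by
      ext x
      simp [Subsingleton.elim x p, hp]
    simp [this] at hδ
  obtain ⟨z, hz⟩ := exists_ne (0 : EuclideanSpace ℝ (Fin M))
  have h1 := inner_add_mul_norm_le_supportFn hT hp z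
  obtain ⟨q, hq, h2, -⟩ := exists_supportFn_eq hT ⟨p, hp⟩ z
  rw [h2, h0 q hq, h0 p hp, inner_zero_left, zero_add] at h1
  rw [h0 p hp] at hδ
  exact absurd h1 (not_le.2 (mul_pos hδ (norm_pos_iff.2 hz)))

theorem isCompact_constraintSet {y : Fin M → ℝ} {U : Fin M → Set ℝ} (hU : ∀ i, IsCompact (U i)) :
    IsCompact (constraintSet y U) := by
  have h : constraintSet y U =
      WithLp.toLp 2 '' Set.univ.pi fun i => (fun u => y i - u) '' U i := by
    ext t
    constructor
    · intro ht
      refine ⟨WithLp.ofLp t, fun i _ => ?_, rfl⟩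
      obtain ⟨u, hu, h⟩ := ht i
      exact ⟨u, hu, h.symm⟩
    · rintro ⟨s, hs, rfl⟩ i
      obtain ⟨u, hu, h⟩ := hs i (Set.mem_univ i)
      exact ⟨u, hu, h.symm⟩
  rw [h]
  exact (isCompact_univ_pi fun i => (hU i).image (by fun_prop)).image
    (PiLp.continuous_toLp 2 _)

theorem convex_constraintSet {y : Fin M → ℝ} {U : Fin M → Set ℝ} (hU : ∀ i, Convex ℝ (U i)) :
    Convex ℝ (constraintSet y U) := by
  intro s hs t ht a b ha hb hab i
  obtain ⟨u, hu, h1⟩ := hs i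
  obtain ⟨v, hv, h2⟩ := ht i
  refine ⟨a • u + b • v, hU i hu hv ha hb hab, ?_⟩
  simp only [PiLp.add_apply, PiLp.smul_apply, smul_eq_mul, h1, h2]
  linear_combination y i * hab

end SupportFn

/-! ### Gibbs measures and the log-partition function. -/

section Entropy

theorem relEnt_ne_top_iff {α : Type*} [MeasurableSpace α] {μ ν : Measure α} :
    relEnt μ ν ≠ ∞ ↔ InformationTheory.klDiv μ ν ≠ ∞ := by
  have h : 0 < Real.log 2 := Real.log_pos one_lt_two
  simp [relEnt, ENNReal.div_eq_top, h]

theorem toReal_relEnt {α : Type*} [MeasurableSpace α] (μ ν : Measure α) :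
    (relEnt μ ν).toReal = (InformationTheory.klDiv μ ν).toReal / Real.log 2 := by
  rw [relEnt, ENNReal.toReal_div, ENNReal.toReal_ofReal (Real.log_nonneg one_le_two)]

theorem toReal_relEnt_pos {α : Type*} [MeasurableSpace α] {μ ν : Measure α} [IsFiniteMeasure μ]
    [IsFiniteMeasure ν] (hfin : relEnt μ ν ≠ ∞) (hne : μ ≠ ν) : 0 < (relEnt μ ν).toReal := by
  rw [toReal_relEnt]
  exact div_pos (ENNReal.toReal_pos (mt InformationTheory.klDiv_eq_zero_iff.1 hne)
    (relEnt_ne_top_iff.1 hfin)) (Real.log_pos one_lt_two)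

/-- The Gibbs variational inequality. -/
theorem neg_log_integral_exp_le {α : Type*} [MeasurableSpace α] {μ ν : Measure α}
    [IsProbabilityMeasure μ] [IsProbabilityMeasure ν] {f : α → ℝ} (hfμ : Integrable f μ)
    (hfν : Integrable (fun x => Real.exp (f x)) ν) (hfin : InformationTheory.klDiv μ ν ≠ ∞) :
    -Real.log (∫ x, Real.exp (f x) ∂ν) ≤ (InformationTheory.klDiv μ ν).toReal - ∫ x, f x ∂μ := by
  obtain ⟨hac, hint⟩ := InformationTheory.klDiv_ne_top_iff.1 hfin
  have := isProbabilityMeasure_tilted hfν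
  -- The inequality is nonnegativity of the divergence of `μ` from the tilted measure.
  have h1 := InformationTheory.toReal_klDiv_of_measure_eq
    (hac.trans (absolutelyContinuous_tilted hfν)) (by simp)
  rw [integral_llr_tilted_right hac hfμ hfν hint] at h1
  rw [InformationTheory.toReal_klDiv_of_measure_eq hac (by simp)]
  have : 0 ≤ (InformationTheory.klDiv μ (ν.tilted f)).toReal := ENNReal.toReal_nonneg
  linarith

theorem klDiv_tilted_self {α : Type*} [MeasurableSpace α] {ν : Measure α}
    [IsProbabilityMeasure ν] {f : α → ℝ} (hfν : Integrable (fun x => Real.exp (f x)) ν)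
    (hf : Integrable f (ν.tilted f)) :
    InformationTheory.klDiv (ν.tilted f) ν ≠ ∞ ∧
      (InformationTheory.klDiv (ν.tilted f) ν).toReal =
        ∫ x, f x ∂(ν.tilted f) - Real.log (∫ x, Real.exp (f x) ∂ν) := by
  have := isProbabilityMeasure_tilted hfν
  have hac := tilted_absolutelyContinuous ν f
  have hllr : llr (ν.tilted f) ν =ᵐ[ν.tilted f]
      fun x => f x - Real.log (∫ x, Real.exp (f x) ∂ν) :=
    hac.ae_le (log_rnDeriv_tilted_left_self hfν)
  have hi : Integrable (fun x => f x - Real.log (∫ x, Real.exp (f x) ∂ν)) (ν.tilted f) :=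
    hf.sub (integrable_const _)
  refine ⟨InformationTheory.klDiv_ne_top hac (hi.congr hllr.symm), ?_⟩
  rw [InformationTheory.toReal_klDiv_of_measure_eq hac (by simp), integral_congr_ae hllr,
    integral_sub hf (integrable_const _)]
  simp

variable {K : Set ℝ} {M : ℕ}

theorem continuous_adjointMoments (z : EuclideanSpace ℝ (Fin M)) :
    Continuous (adjointMoments z) := by
  unfold adjointMoments
  fun_prop

theorem integrable_of_continuous [CompactSpace K] (μ : Measure K) [IsFiniteMeasure μ]
    {f : K → ℝ} (hf : Continuous f) : Integrable f μ :=
  hf.integrable_of_hasCompactSupport (HasCompactSupport.of_compactSpace f)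

theorem inner_moments [CompactSpace K] (μ : Measure K) [IsFiniteMeasure μ]
    (z : EuclideanSpace ℝ (Fin M)) :
    inner ℝ (moments M μ) z = ∫ x : K, adjointMoments z x ∂μ := by
  unfold adjointMoments
  rw [integral_finsetSum _ fun i _ => integrable_of_continuous μ (by fun_prop)]
  simp only [PiLp.inner_apply, moments, integral_const_mul]
  simp

/-- The exponent of the Gibbs density. -/
noncomputable def gibbsExponent (K : Set ℝ) (z : EuclideanSpace ℝ (Fin M)) (x : K) : ℝ :=
  -(Real.log 2 * adjointMoments z x)

theorem continuous_gibbsExponent (z : EuclideanSpace ℝ (Fin M)) :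
    Continuous (gibbsExponent K z) := by
  unfold gibbsExponent
  have := continuous_adjointMoments z
  fun_prop

theorem integrable_gibbsExponent [CompactSpace K] (μ : Measure K) [IsFiniteMeasure μ]
    (z : EuclideanSpace ℝ (Fin M)) : Integrable (gibbsExponent K z) μ :=
  integrable_of_continuous μ (continuous_gibbsExponent z)

theorem integrable_exp_gibbsExponent [CompactSpace K] (μ : Measure K) [IsFiniteMeasure μ]
    (z : EuclideanSpace ℝ (Fin M)) : Integrable (fun x => Real.exp (gibbsExponent K z x)) μ :=
  integrable_of_continuous μ (Real.continuous_exp.comp (continuous_gibbsExponent z))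

theorem integral_gibbsExponent [CompactSpace K] (μ : Measure K) [IsFiniteMeasure μ]
    (z : EuclideanSpace ℝ (Fin M)) :
    ∫ x, gibbsExponent K z x ∂μ = -(Real.log 2 * inner ℝ (moments M μ) z) := by
  simp only [gibbsExponent, integral_neg, integral_const_mul, inner_moments]

/-- The logarithm to base `2` of the partition function. -/
noncomputable def logPartition (ν : ProbabilityMeasure K) (z : EuclideanSpace ℝ (Fin M)) : ℝ :=
  Real.log (∫ x, Real.exp (gibbsExponent K z x) ∂(ν : Measure K)) / Real.log 2

theorem gibbs_eq_tilted [CompactSpace K] (ν : ProbabilityMeasure K)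
    (z : EuclideanSpace ℝ (Fin M)) :
    gibbs ν z = (ν : Measure K).tilted (gibbsExponent K z) := by
  have h2 : ∀ x : K, (2 : ℝ) ^ (-adjointMoments z x) = Real.exp (gibbsExponent K z x) := fun x => by
    rw [Real.rpow_def_of_pos two_pos, gibbsExponent]; ring_nf
  have hi := integrable_exp_gibbsExponent (ν : Measure K) z
  have hpos := integral_exp_pos hi
  have hm : Measurable fun x => ENNReal.ofReal (Real.exp (gibbsExponent K z x)) := by
    have := (continuous_gibbsExponent (K := K) z).measurable
    fun_prop
  simp only [gibbs, h2, Measure.tilted]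
  rw [← ofReal_integral_eq_lintegral_ofReal hi (ae_of_all _ fun x => (Real.exp_pos _).le),
    ← withDensity_smul _ hm]
  congr 1
  ext x
  rw [Pi.smul_apply, smul_eq_mul, div_eq_inv_mul, ENNReal.ofReal_mul (inv_nonneg.2 hpos.le),
    ENNReal.ofReal_inv_of_pos hpos]

theorem isProbabilityMeasure_gibbs [CompactSpace K] (ν : ProbabilityMeasure K)
    (z : EuclideanSpace ℝ (Fin M)) : IsProbabilityMeasure (gibbs ν z) := by
  rw [gibbs_eq_tilted]
  exact isProbabilityMeasure_tilted (integrable_exp_gibbsExponent _ z)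

theorem neg_logPartition_le [CompactSpace K] (ν : ProbabilityMeasure K) (μ : Measure K)
    [IsProbabilityMeasure μ] (z : EuclideanSpace ℝ (Fin M)) (hfin : relEnt μ ν ≠ ∞) :
    -logPartition ν z ≤ (relEnt μ ν).toReal + inner ℝ (moments M μ) z := by
  have hl : 0 < Real.log 2 := Real.log_pos one_lt_two
  have h := neg_log_integral_exp_le (integrable_gibbsExponent μ z)
    (integrable_exp_gibbsExponent (ν : Measure K) z) (relEnt_ne_top_iff.1 hfin)
  rw [integral_gibbsExponent] at h
  rw [logPartition, toReal_relEnt, ← neg_div, div_add' _ _ _ hl.ne']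
  refine (div_le_div_iff_of_pos_right hl).2 ?_
  linarith

theorem relEnt_gibbs [CompactSpace K] (ν : ProbabilityMeasure K) (z : EuclideanSpace ℝ (Fin M)) :
    relEnt (gibbs ν z) ν ≠ ∞ ∧
      (relEnt (gibbs ν z) ν).toReal = -logPartition ν z - inner ℝ (moments M (gibbs ν z)) z := by
  have hl : 0 < Real.log 2 := Real.log_pos one_lt_two
  have := isProbabilityMeasure_gibbs ν z
  have hi := integrable_gibbsExponent (gibbs ν z) z
  have hint := integral_gibbsExponent (gibbs ν z) z
  rw [relEnt_ne_top_iff, toReal_relEnt, logPartition]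
  rw [gibbs_eq_tilted] at hi hint ⊢
  obtain ⟨h1, h2⟩ := klDiv_tilted_self (integrable_exp_gibbsExponent (ν : Measure K) z) hi
  refine ⟨h1, ?_⟩
  rw [h2, hint]
  field_simp
  ring

theorem entropyTerm_eq [CompactSpace K] (ν : ProbabilityMeasure K)
    (z : EuclideanSpace ℝ (Fin M)) : entropyTerm ν z = -logPartition ν z := by
  have key : (⨅ μ : ProbabilityMeasure K, ((relEnt (μ : Measure K) ν : ℝ≥0∞) : EReal) +
      ((inner ℝ (moments M (μ : Measure K)) z : ℝ) : EReal)) = ((-logPartition ν z : ℝ) : EReal) := by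
    apply le_antisymm
    · have := isProbabilityMeasure_gibbs ν z
      refine (iInf_le _ (⟨gibbs ν z, this⟩ : ProbabilityMeasure K)).trans (le_of_eq ?_)
      obtain ⟨h1, h2⟩ := relEnt_gibbs ν z
      simp only [ProbabilityMeasure.coe_mk]
      rw [← EReal.coe_ennreal_toReal h1, ← EReal.coe_add, h2]
      congr 1
      ring
    · refine le_iInf fun μ => ?_
      by_cases h : relEnt (μ : Measure K) ν = ∞
      · rw [h, EReal.coe_ennreal_top, EReal.top_add_coe]
        exact le_top
      · rw [← EReal.coe_ennreal_toReal h, ← EReal.coe_add, EReal.coe_le_coe_iff]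
        exact neg_logPartition_le ν μ z h
  rw [entropyTerm, key, EReal.toReal_coe]

theorem adjointMoments_add (z d : EuclideanSpace ℝ (Fin M)) (x : ℝ) :
    adjointMoments (z + d) x = adjointMoments z x + adjointMoments d x := by
  simp [adjointMoments, add_mul, Finset.sum_add_distrib]

/-- Tilting twice adds exponents, so an increment is the logarithm of a moment generating function
under the Gibbs measure at `z`; Jensen and Hoeffding then control it. -/
theorem logPartition_add [CompactSpace K] (ν : ProbabilityMeasure K)
    (z d : EuclideanSpace ℝ (Fin M)) :
    logPartition ν (z + d) = logPartition ν z +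
      Real.log (∫ x, Real.exp (gibbsExponent K d x) ∂(gibbs ν z)) / Real.log 2 := by
  have hz := integral_exp_pos (integrable_exp_gibbsExponent (ν : Measure K) z)
  have hzd := integral_exp_pos (integrable_exp_gibbsExponent (ν : Measure K) (z + d))
  have e : gibbsExponent K z + gibbsExponent K d = gibbsExponent K (z + d) := by
    ext x
    simp only [Pi.add_apply, gibbsExponent, adjointMoments_add]
    ring
  rw [gibbs_eq_tilted, integral_exp_tilted, e, Real.log_div hzd.ne' hz.ne', logPartition,
    logPartition]
  ring

/-- The moments of the Dirac measure at `x`. -/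
noncomputable def monomialVector (M : ℕ) (x : ℝ) : EuclideanSpace ℝ (Fin M) :=
  WithLp.toLp 2 fun i => x ^ ((i : ℕ) + 1)

theorem adjointMoments_eq_inner (z : EuclideanSpace ℝ (Fin M)) (x : ℝ) :
    adjointMoments z x = inner ℝ (monomialVector M x) z := by
  simp [adjointMoments, monomialVector, PiLp.inner_apply]

theorem abs_adjointMoments_le {R : ℝ} (hR : ∀ x ∈ K, ‖monomialVector M x‖ ≤ R)
    (z : EuclideanSpace ℝ (Fin M)) {x : ℝ} (hx : x ∈ K) : |adjointMoments z x| ≤ R * ‖z‖ := by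
  rw [adjointMoments_eq_inner]
  exact (abs_real_inner_le_norm _ _).trans
    (mul_le_mul_of_nonneg_right (hR x hx) (norm_nonneg z))

/-- The moments of the Gibbs measure are the gradient of the negative log-partition function, whose
curvature is bounded by Hoeffding's lemma. -/
theorem quadBounds_logPartition [CompactSpace K] (ν : ProbabilityMeasure K) {R : ℝ}
    (hR : ∀ x ∈ K, ‖monomialVector M x‖ ≤ R) :
    QuadBounds (logPartition (M := M) ν) (fun z => -moments M (gibbs ν z)) 0 (R ^ 2) := by
  intro z d
  have hl : 0 < Real.log 2 := Real.log_pos one_lt_two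
  have := isProbabilityMeasure_gibbs ν z
  have hi := integrable_exp_gibbsExponent (gibbs ν z) d
  have hpos := integral_exp_pos hi
  rw [logPartition_add, inner_neg_left]
  set G := inner ℝ (moments M (gibbs ν z)) d with hG
  constructor
  · have h1 : -(Real.log 2 * G) ≤ Real.log (∫ x, Real.exp (gibbsExponent K d x) ∂(gibbs ν z)) := by
      rw [hG, ← integral_gibbsExponent, Real.le_log_iff_exp_le hpos]
      exact convexOn_exp.map_integral_le Real.continuous_exp.continuousOn isClosed_univ
        (ae_of_all _ fun _ => Set.mem_univ _) (integrable_gibbsExponent _ d) hi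
    have h2 : -G ≤ Real.log (∫ x, Real.exp (gibbsExponent K d x) ∂(gibbs ν z)) / Real.log 2 := by
      rw [le_div_iff₀ hl]; linarith
    linarith
  · set r := R * ‖d‖
    have hX : ∀ᵐ x : K ∂(gibbs ν z), -adjointMoments d (x : ℝ) ∈ Set.Icc (-r) r :=
      ae_of_all _ fun x => by
        have := abs_le.1 (abs_adjointMoments_le hR d x.2)
        exact ⟨by linarith [this.2], by linarith [this.1]⟩
    have hm : AEMeasurable (fun x : K => -adjointMoments d (x : ℝ)) (gibbs ν z) :=
      (((continuous_adjointMoments d).comp continuous_subtype_val).neg).measurable.aemeasurable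
    have hH := (ProbabilityTheory.hasSubgaussianMGF_of_mem_Icc hm hX).mgf_le (Real.log 2)
    rw [integral_neg, ← inner_moments, ← hG, ProbabilityTheory.mgf] at hH
    have e1 : ∀ x : K, Real.exp (Real.log 2 * (-adjointMoments d (x : ℝ) - -G)) =
        Real.exp (gibbsExponent K d x) * Real.exp (Real.log 2 * G) := fun x => by
      rw [← Real.exp_add, gibbsExponent]; ring_nf
    simp only [e1, integral_mul_const] at hH
    have e2 : (((‖r - -r‖₊ / 2 : NNReal) ^ 2 : NNReal) : ℝ) = r ^ 2 := by
      push_cast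
      rw [div_pow, Real.norm_eq_abs, sq_abs]
      ring
    rw [e2] at hH
    have h3 := Real.log_le_log (by positivity) hH
    rw [Real.log_mul hpos.ne' (Real.exp_pos _).ne', Real.log_exp, Real.log_exp] at h3
    have h4 : Real.log (∫ x, Real.exp (gibbsExponent K d x) ∂(gibbs ν z)) / Real.log 2 ≤
        -G + r ^ 2 / 2 := by
      rw [div_le_iff₀ hl]
      -- Hoeffding gives `r ^ 2 * log 2 / 2` after division by `log 2`; base `2` costs nothing since
      -- `log 2 ≤ 1`.
      have h5 : Real.log 2 ≤ 1 := Real.log_two_lt_d9.le.trans (by norm_num)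
      have h6 : r ^ 2 * Real.log 2 * Real.log 2 ≤ r ^ 2 * Real.log 2 * 1 := by gcongr
      nlinarith
    have e3 : R ^ 2 / 2 * ‖d‖ ^ 2 = r ^ 2 / 2 := by simp only [r]; ring
    linarith

end Entropy

/-! ### The operator norm of the moment map. -/

section MomentNorm

variable {K : Set ℝ} {M : ℕ}

theorem norm_moments_le [CompactSpace K] {B : ℝ} (hB0 : 0 ≤ B)
    (hB : ∀ x : K, ‖monomialVector M x‖ ≤ B) (μ : Measure K) [IsFiniteMeasure μ] :
    ‖moments M μ‖ ≤ B * μ.real Set.univ := by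
  have h : ‖moments M μ‖ * ‖moments M μ‖ ≤ (B * μ.real Set.univ) * ‖moments M μ‖ := by
    rw [← real_inner_self_eq_norm_mul_norm, inner_moments]
    calc ∫ x : K, adjointMoments (moments M μ) x ∂μ ≤ ∫ _x : K, B * ‖moments M μ‖ ∂μ := by
          refine integral_mono (integrable_of_continuous μ
            ((continuous_adjointMoments _).comp continuous_subtype_val)) (integrable_const _)
            fun x => ?_
          exact (le_abs_self _).trans
            (abs_adjointMoments_le (K := K) (fun x hx => hB ⟨x, hx⟩) _ x.2)
      _ = _ := by rw [integral_const, smul_eq_mul]; ring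
  rcases (norm_nonneg (moments M μ)).eq_or_lt with h0 | h0
  · rw [← h0]
    exact mul_nonneg hB0 measureReal_nonneg
  · exact le_of_mul_le_mul_right h h0

theorem bddAbove_momentNorm_set [CompactSpace K] :
    BddAbove {r : ℝ | ∃ (s : SignedMeasure K) (v : EuclideanSpace ℝ (Fin M)),
      s.totalVariation Set.univ = 1 ∧ ‖v‖ = 1 ∧ r = inner ℝ (signedMoments M s) v} := by
  have hc : Continuous fun x : K => ‖monomialVector M (x : ℝ)‖ := by
    unfold monomialVector
    fun_prop
  obtain ⟨B, hB⟩ := (isCompact_range hc).bddAbove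
  have hB0 : 0 ≤ max B 0 := le_max_right _ _
  have hB' : ∀ x : K, ‖monomialVector M x‖ ≤ max B 0 := fun x =>
    (hB ⟨x, rfl⟩).trans (le_max_left _ _)
  refine ⟨max B 0, ?_⟩
  rintro r ⟨s, v, hs, hv, rfl⟩
  set p := s.toJordanDecomposition.posPart
  set n := s.toJordanDecomposition.negPart
  have h1 : p.real Set.univ + n.real Set.univ = 1 := by
    rw [SignedMeasure.totalVariation, Measure.add_apply] at hs
    rw [measureReal_def, measureReal_def, ← ENNReal.toReal_add (by finiteness) (by finiteness), hs,
      ENNReal.toReal_one]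
  calc inner ℝ (signedMoments M s) v ≤ ‖signedMoments M s‖ * ‖v‖ := real_inner_le_norm _ _
    _ ≤ ‖moments M p‖ + ‖moments M n‖ := by
        rw [hv, mul_one]; exact norm_sub_le _ _
    _ ≤ max B 0 * p.real Set.univ + max B 0 * n.real Set.univ :=
        add_le_add (norm_moments_le hB0 hB' p) (norm_moments_le hB0 hB' n)
    _ = max B 0 := by rw [← mul_add, h1, mul_one]

/-- Test the supremum with the Dirac mass at `x`. This supplies the bound `R` for Hoeffding's lemma.
-/
theorem norm_monomialVector_le_momentNorm [CompactSpace K] {x : ℝ} (hx : x ∈ K) :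
    ‖monomialVector M x‖ ≤ momentNorm K M := by
  set φ := monomialVector M x with hφ
  let ξ : K := ⟨x, hx⟩
  let j : JordanDecomposition K :=
    { posPart := Measure.dirac ξ
      negPart := 0
      posPart_finite := inferInstance
      negPart_finite := inferInstance
      mutuallySingular := Measure.MutuallySingular.zero_right }
  have hj : j.toSignedMeasure.toJordanDecomposition = j := SignedMeasure.toJordanDecomposition_eq rfl
  have hmom : signedMoments M j.toSignedMeasure = φ := by
    ext i
    simp [signedMoments, hj, j, moments, hφ, monomialVector, ξ]
  have htv : j.toSignedMeasure.totalVariation Set.univ = 1 := by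
    simp [SignedMeasure.totalVariation, hj, j]
  have key : ∀ v : EuclideanSpace ℝ (Fin M), ‖v‖ = 1 → inner ℝ φ v ≤ momentNorm K M := fun v hv =>
    le_csSup bddAbove_momentNorm_set ⟨j.toSignedMeasure, v, htv, hv, by rw [hmom]⟩
  rcases eq_or_ne φ 0 with h0 | h0
  · rw [h0, norm_zero]
    rcases subsingleton_or_nontrivial (EuclideanSpace ℝ (Fin M)) with hs | hs
    -- There are no unit vectors here, so the supremum is over the empty set.
    · refine Real.sSup_nonneg ?_
      rintro r ⟨s, v, -, hv, rfl⟩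
      simp [Subsingleton.elim v 0] at hv
    · obtain ⟨v, hv⟩ := exists_norm_eq (EuclideanSpace ℝ (Fin M)) zero_le_one
      simpa [h0] using key v hv
  · have hn : ‖φ‖ ≠ 0 := norm_ne_zero_iff.2 h0
    have := key (‖φ‖⁻¹ • φ) (by rw [norm_smul, norm_inv, norm_norm, inv_mul_cancel₀ hn])
    rwa [inner_smul_right, real_inner_self_eq_norm_sq, pow_two, inv_mul_cancel_left₀ hn] at this

end MomentNorm

/-! ### Duality and smoothing. -/

section Dual

variable {K : Set ℝ} {M : ℕ}

variable {ν μ₀ : ProbabilityMeasure K} {T : Set (EuclideanSpace ℝ (Fin M))} {η₁ η₂ : ℝ}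

theorem primalValue_ne_top (hfeas : moments M (μ₀ : Measure K) ∈ T)
    (hfin : relEnt (μ₀ : Measure K) ν ≠ ∞) : primalValue ν T ≠ ∞ :=
  ne_top_of_le_ne_top hfin (iInf₂_le μ₀ hfeas)

theorem toReal_primalValue_le (hfeas : moments M (μ₀ : Measure K) ∈ T)
    (hfin : relEnt (μ₀ : Measure K) ν ≠ ∞) : (primalValue ν T).toReal ≤ constC ν μ₀ :=
  ENNReal.toReal_mono hfin (iInf₂_le μ₀ hfeas)

theorem dualFn_sub_le_smoothedDualFn (hT : IsCompact T) (hne : T.Nonempty) (hη₁ : 0 ≤ η₁)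
    (z : EuclideanSpace ℝ (Fin M)) :
    dualFn ν T z - η₂ / 2 * ‖z‖ ^ 2 ≤ smoothedDualFn ν T η₁ η₂ z := by
  have := regularized_le_supportFn hT hne hη₁ z
  rw [dualFn, smoothedDualFn]
  linarith

theorem smoothedDualFn_le (hT : IsCompact T) (hne : T.Nonempty) (hη₁ : 0 ≤ η₁)
    (z : EuclideanSpace ℝ (Fin M)) :
    smoothedDualFn ν T η₁ η₂ z ≤ dualFn ν T z + η₁ * constD T - η₂ / 2 * ‖z‖ ^ 2 := by
  have := supportFn_le_regularized_add hT hne hη₁ z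
  rw [dualFn, smoothedDualFn]
  linarith

section Duality

variable [CompactSpace K]

theorem continuous_logPartition (ν : ProbabilityMeasure K) :
    Continuous (logPartition (M := M) ν) :=
  (quadBounds_logPartition ν fun _ hx => norm_monomialVector_le_momentNorm hx).continuous

theorem dualFn_eq (ν : ProbabilityMeasure K) (T : Set (EuclideanSpace ℝ (Fin M)))
    (z : EuclideanSpace ℝ (Fin M)) : dualFn ν T z = -supportFn T z - logPartition ν z := by
  rw [dualFn, entropyTerm_eq, sub_eq_add_neg]

theorem dualFn_le_primalValue (hT : IsCompact T) (hfin : primalValue ν T ≠ ∞)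
    (z : EuclideanSpace ℝ (Fin M)) : dualFn ν T z ≤ (primalValue ν T).toReal := by
  rw [← ENNReal.ofReal_le_iff_le_toReal hfin]
  refine le_iInf₂ fun μ hμ => ?_
  by_cases h : relEnt (μ : Measure K) ν = ∞
  · rw [h]; exact le_top
  · rw [ENNReal.ofReal_le_iff_le_toReal h, dualFn_eq]
    have := neg_logPartition_le ν μ z h
    linarith [inner_le_supportFn hT hμ z]

theorem dualFn_zero (hT : IsCompact T) (hne : T.Nonempty) : dualFn ν T 0 = 0 := by
  obtain ⟨p, -, h, -⟩ := exists_supportFn_eq hT hne 0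
  rw [inner_zero_right] at h
  simp [dualFn_eq, h, logPartition, gibbsExponent, adjointMoments]

/-- A Slater point makes the dual function coercive. -/
theorem dualFn_le_sub_norm (hT : IsCompact T) (hfeas : moments M (μ₀ : Measure K) ∈ T)
    (hfin : relEnt (μ₀ : Measure K) ν ≠ ∞) (z : EuclideanSpace ℝ (Fin M)) :
    dualFn ν T z ≤ constC ν μ₀ - constδ T μ₀ * ‖z‖ := by
  have h1 := inner_add_mul_norm_le_supportFn hT hfeas z
  have h2 := neg_logPartition_le ν (μ₀ : Measure K) z hfin
  rw [dualFn_eq, constC, constδ]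
  linarith

/-- At a maximizer of the dual function the Gibbs measure is feasible and satisfies complementary
slackness. -/
theorem gibbs_feasible_of_isMax (hT : IsCompact T) (hconv : Convex ℝ T) (hne : T.Nonempty)
    {p : EuclideanSpace ℝ (Fin M)} (hp : ∀ z, dualFn ν T z ≤ dualFn ν T p) :
    moments M (gibbs ν p) ∈ T ∧ supportFn T p = inner ℝ (moments M (gibbs ν p)) p := by
  have hq := quadBounds_logPartition (M := M) ν fun _ hx => norm_monomialVector_le_momentNorm hx
  -- First-order optimality in direction `d`, where `c` bounds the growth rate of the support
  -- function. Arbitrary `d` gives membership in `T`; `d = -p` gives complementary slackness by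
  -- homogeneity.
  have hdir : ∀ (d : EuclideanSpace ℝ (Fin M)) (c : ℝ),
      (∀ t : ℝ, 0 < t → t ≤ 1 → supportFn T (p + t • d) ≤ supportFn T p + t * c) →
      inner ℝ (moments M (gibbs ν p)) d ≤ c := by
    intro d c hc
    rw [← sub_nonpos]
    refine nonpos_of_forall_le_mul (B := momentNorm K M ^ 2 / 2 * ‖d‖ ^ 2) fun t ht0 ht1 => ?_
    have h1 := hp (p + t • d)
    have h2 := (hq p (t • d)).2
    rw [dualFn_eq, dualFn_eq] at h1
    rw [inner_neg_left, inner_smul_right, norm_smul, mul_pow, Real.norm_eq_abs, sq_abs] at h2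
    have h3 := hc t ht0 ht1
    refine le_of_mul_le_mul_left ?_ ht0
    linarith
  have hmem : moments M (gibbs ν p) ∈ T :=
    mem_of_forall_inner_le_supportFn hT hconv hne fun d =>
      hdir d _ fun t ht0 _ => supportFn_add_smul_le hT hne p d ht0.le
  refine ⟨hmem, le_antisymm ?_ (inner_le_supportFn hT hmem p)⟩
  have := hdir (-p) (-supportFn T p) fun t _ ht1 => by
    have h := supportFn_smul_le hT hne p (sub_nonneg.2 ht1)
    have e : p + t • -p = (1 - t) • p := by module
    rw [e]
    linarith
  rw [inner_neg_right] at this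
  linarith

/-- Strong duality, with a bound on a dual optimizer. -/
theorem exists_dual_optimizer (hT : IsCompact T) (hconv : Convex ℝ T)
    (hfeas : moments M (μ₀ : Measure K) ∈ T) (hfin : relEnt (μ₀ : Measure K) ν ≠ ∞)
    (hδ : 0 < constδ T μ₀) :
    ∃ p, dualFn ν T p = (primalValue ν T).toReal ∧ constδ T μ₀ * ‖p‖ ≤ constC ν μ₀ := by
  have hne : T.Nonempty := ⟨_, hfeas⟩
  have hcont : Continuous fun z => -dualFn ν T z := by
    simp only [dualFn_eq]
    exact ((continuous_supportFn hT hne).neg.sub (continuous_logPartition ν)).neg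
  obtain ⟨p, hp⟩ := exists_forall_le_of_coercive hcont hδ (b := constC ν μ₀) fun z => by
    linarith [dualFn_le_sub_norm hT hfeas hfin z]
  have hp' : ∀ z, dualFn ν T z ≤ dualFn ν T p := fun z => neg_le_neg_iff.1 (hp z)
  obtain ⟨h1, h2⟩ := gibbs_feasible_of_isMax hT hconv hne hp'
  have hprob := isProbabilityMeasure_gibbs ν p
  obtain ⟨h3, h4⟩ := relEnt_gibbs ν p
  refine ⟨p, le_antisymm (dualFn_le_primalValue hT (primalValue_ne_top hfeas hfin) p) ?_, ?_⟩
  · have h5 : (primalValue ν T).toReal ≤ (relEnt (gibbs ν p) ν).toReal :=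
      toReal_primalValue_le (μ₀ := ⟨gibbs ν p, hprob⟩) h1 h3
    rw [h4] at h5
    rw [dualFn_eq, h2]
    linarith
  -- Comparison with `F(0) = 0` bounds the maximizer.
  · have h5 := hp' 0
    rw [dualFn_zero hT hne] at h5
    linarith [dualFn_le_sub_norm hT hfeas hfin p]

/-- The negative of the smoothed dual function is strongly convex and smooth; its gradient is
expressed through a point of `T` that nearly attains the support function and the moments of the
Gibbs measure. -/
theorem exists_smoothedDualFn_gradient (ν : ProbabilityMeasure K) (hT : IsCompact T)
    (hconv : Convex ℝ T) (hne : T.Nonempty) (hη₁ : 0 < η₁) (η₂ : ℝ) :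
    ∃ q : EuclideanSpace ℝ (Fin M) → EuclideanSpace ℝ (Fin M),
      (∀ z, q z ∈ T) ∧ (∀ z, supportFn T z ≤ inner ℝ (q z) z + η₁ * constD T) ∧
      QuadBounds (fun z => -smoothedDualFn ν T η₁ η₂ z)
        (fun z => q z - moments M (gibbs ν z) + η₂ • z) η₂ (lipConst K M η₁ η₂) := by
  obtain ⟨q, hqT, hqS, hq⟩ := exists_regularized_support hT hconv hne hη₁
  refine ⟨q, hqT, fun z => ?_, ?_⟩
  · have h1 := supportFn_le_regularized_add hT hne hη₁.le z
    rw [hqS] at h1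
    have : 0 ≤ η₁ / 2 * ‖q z‖ ^ 2 := by positivity
    linarith
  · have h := (hq.add (quadBounds_logPartition ν fun _ hx =>
      norm_monomialVector_le_momentNorm hx)).add (quadBounds_norm_sq η₂)
    convert h using 1
    · ext z
      rw [smoothedDualFn, entropyTerm_eq]
      ring
    · funext z
      rw [sub_eq_add_neg]
    · ring
    · rfl

end Duality

theorem exp_neg_div_le_of_mul_log_le {A r N : ℝ} (hA : 0 < A) (hr : 0 < r)
    (h : 2 * r * Real.log A ≤ N) : Real.exp (-(N / r)) ≤ (A ^ 2)⁻¹ := by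
  rw [← Real.exp_log (pow_pos hA 2), ← Real.exp_neg, Real.exp_le_exp, neg_le_neg_iff,
    le_div_iff₀ hr, Real.log_pow]
  push_cast
  linarith

end Dual

/-! ### From iteration count to accuracy. -/

section Accuracy

variable {K : Set ℝ} {M : ℕ}

/-- A point that nearly maximizes the smoothed dual function, with a small gradient there, yields
approximate solutions of the dual and the primal problem. -/
theorem accuracy_of_small_gap [CompactSpace K] {ν μ₀ : ProbabilityMeasure K}
    {T : Set (EuclideanSpace ℝ (Fin M))} {C δ η₁ η₂ ε : ℝ} (hT : IsCompact T)
    (hconv : Convex ℝ T) (hfeas : moments M (μ₀ : Measure K) ∈ T)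
    (hfin : relEnt (μ₀ : Measure K) ν ≠ ∞) (hC : C = constC ν μ₀) (hδ : δ = constδ T μ₀)
    (hCpos : 0 < C) (hδpos : 0 < δ) (hε : 0 < ε) (hη₁ : 0 ≤ η₁) (hη₁D : η₁ * constD T = ε / 4)
    (hη₂ : η₂ = ε * δ ^ 2 / (2 * C ^ 2)) {z q g : EuclideanSpace ℝ (Fin M)} (hq : q ∈ T)
    (hqz : supportFn T z ≤ inner ℝ q z + η₁ * constD T)
    (hg : g = q - moments M (gibbs ν z) + η₂ • z)
    (hgap : ∀ x, smoothedDualFn ν T η₁ η₂ x - smoothedDualFn ν T η₁ η₂ z ≤ ε / 100)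
    (hgrad : ‖g‖ ≤ ε * δ * (2 - √3) / C) :
    (primalValue ν T).toReal - dualFn ν T z ≤ ε ∧
      |(relEnt (gibbs ν z) ν).toReal - (primalValue ν T).toReal| ≤ 2 * (1 + 2 * √3) * ε ∧
      Metric.infDist (moments M (gibbs ν z)) T ≤ 2 * ε * δ / C := by
  have hne : T.Nonempty := ⟨_, hfeas⟩
  obtain ⟨p, hp, hpn⟩ := exists_dual_optimizer hT hconv hfeas hfin (hδ ▸ hδpos)
  rw [← hC, ← hδ] at hpn
  have hweak := dualFn_le_primalValue hT (primalValue_ne_top hfeas hfin) z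
  set J := (primalValue ν T).toReal
  set m := moments M (gibbs ν z)
  have hs1 : (1.7 : ℝ) ≤ √3 := Real.le_sqrt_of_sq_le (by norm_num)
  have hs2 : √3 ≤ 1.8 := (Real.sqrt_le_left (by norm_num)).2 (by norm_num)
  have hη₂pos : 0 < η₂ := by rw [hη₂]; positivity
  -- The norm of `z` in units of the bound `C / δ` on the dual optimizer.
  set u := δ * ‖z‖ / C with hu
  have hu0 : 0 ≤ u := by positivity
  have e1 : η₂ * ‖z‖ ^ 2 = ε / 2 * u ^ 2 := by rw [hη₂, hu]; field_simp
  have e2 : η₂ * ‖z‖ = ε * δ / C * (u / 2) := by rw [hη₂, hu]; field_simp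
  have e3 : η₂ / 2 * ‖p‖ ^ 2 ≤ ε / 4 := by
    have h1 : δ * ‖p‖ / C ≤ 1 := (div_le_one hCpos).2 hpn
    have h2 : η₂ / 2 * ‖p‖ ^ 2 = ε / 4 * (δ * ‖p‖ / C) ^ 2 := by rw [hη₂]; field_simp; ring
    have h3 : (δ * ‖p‖ / C) ^ 2 ≤ 1 := pow_le_one₀ (by positivity) h1
    rw [h2]
    nlinarith
  have h1 := dualFn_sub_le_smoothedDualFn (ν := ν) (η₂ := η₂) hT hne hη₁ p
  have h2 := smoothedDualFn_le (ν := ν) (η₂ := η₂) hT hne hη₁ z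
  have h3 := hgap p
  have hz0 : 0 ≤ η₂ / 2 * ‖z‖ ^ 2 := by positivity
  -- The two smoothing errors and the gap give `ε / 4 * u ^ 2 ≤ ε / 4 + ε / 4 + ε / 100`, and `2.04
  -- = 4 * 0.51`.
  have hu2 : u ^ 2 ≤ 2.04 := by
    have : ε / 4 * u ^ 2 ≤ ε / 4 * 2.04 := by linarith
    exact le_of_mul_le_mul_left this (by positivity)
  have hu1 : u ≤ 2 := by nlinarith
  refine ⟨by linarith, ?_, ?_⟩
  · obtain ⟨-, h4⟩ := relEnt_gibbs ν z
    have h5 : inner ℝ g z = inner ℝ q z - inner ℝ m z + η₂ * ‖z‖ ^ 2 := by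
      rw [hg, inner_add_left, inner_sub_left, inner_smul_left, real_inner_self_eq_norm_sq]
      simp
    have h6 : |inner ℝ g z| ≤ 0.6 * ε := by
      calc |inner ℝ g z| ≤ ‖g‖ * ‖z‖ := abs_real_inner_le_norm _ _
        _ ≤ ε * δ * (2 - √3) / C * ‖z‖ := mul_le_mul_of_nonneg_right hgrad (norm_nonneg _)
        _ = ε * ((2 - √3) * u) := by rw [hu]; ring
        _ ≤ ε * (0.3 * 2) := by
            gcongr
            linarith
        _ = 0.6 * ε := by ring
    have h7 := inner_le_supportFn hT hq z
    have h8 : ε / 2 * u ^ 2 ≤ ε / 2 * 2.04 := by gcongr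
    have h9 : 2 * (1 + 2 * 1.7) * ε ≤ 2 * (1 + 2 * √3) * ε := by gcongr
    rw [dualFn_eq] at h2 hweak
    obtain ⟨h10, h11⟩ := abs_le.1 h6
    refine le_trans ?_ h9
    rw [h4, abs_le]
    constructor <;> linarith
  · have h4 : m - q = η₂ • z - g := by rw [hg]; abel
    have h5 : ε * δ / C * (u / 2) ≤ ε * δ / C * 1 := by
      gcongr
      linarith
    have h6 : ε * δ * (2 - √3) / C = ε * δ / C * (2 - √3) := by ring
    have h7 : ε * δ / C * (2 - √3) ≤ ε * δ / C * 1 := by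
      gcongr
      linarith
    have h8 : 2 * ε * δ / C = 2 * (ε * δ / C) := by ring
    calc Metric.infDist m T ≤ dist m q := Metric.infDist_le_dist_of_mem hq
      _ = ‖η₂ • z - g‖ := by rw [dist_eq_norm, h4]
      _ ≤ η₂ * ‖z‖ + ‖g‖ := by
          refine (norm_sub_le _ _).trans (le_of_eq ?_)
          rw [norm_smul, Real.norm_of_nonneg hη₂pos.le]
      _ ≤ 2 * ε * δ / C := by linarith

/-- The gap and the gradient of the smoothed dual function after `numIter` iterations. -/
theorem fastGradient_gap [CompactSpace K] {ν μ₀ : ProbabilityMeasure K}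
    {T : Set (EuclideanSpace ℝ (Fin M))} {C δ D η₁ η₂ ε : ℝ} (hT : IsCompact T)
    (hfeas : moments M (μ₀ : Measure K) ∈ T)
    (hfin : relEnt (μ₀ : Measure K) ν ≠ ∞) (hC : C = constC ν μ₀) (hδ : δ = constδ T μ₀)
    (hD : D = constD T) (hCpos : 0 < C) (hδpos : 0 < δ) (hDpos : 0 < D) (hε : 0 < ε)
    (hη₁ : η₁ = ε / (4 * D)) (hη₂ : η₂ = ε * δ ^ 2 / (2 * C ^ 2))
    {g : EuclideanSpace ℝ (Fin M) → EuclideanSpace ℝ (Fin M)}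
    (hg : QuadBounds (fun z => -smoothedDualFn ν T η₁ η₂ z) g η₂ (lipConst K M η₁ η₂))
    {y₀ z : EuclideanSpace ℝ (Fin M)}
    (hy₀ : smoothedDualFn ν T η₁ η₂ 0 ≤ smoothedDualFn ν T η₁ η₂ y₀)
    (hz : z = (fastGradient ν T η₁ η₂ y₀ (numIter C D δ (momentNorm K M) ε)).1) :
    (∀ x, smoothedDualFn ν T η₁ η₂ x - smoothedDualFn ν T η₁ η₂ z ≤ ε / 100) ∧
      ‖g z‖ ≤ ε * δ * (2 - √3) / C := by
  have hne : T.Nonempty := ⟨_, hfeas⟩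
  set a := momentNorm K M
  set L := lipConst K M η₁ η₂ with hL
  set F := smoothedDualFn ν T η₁ η₂
  have hη₁pos : 0 < η₁ := by rw [hη₁]; positivity
  have hη₂pos : 0 < η₂ := by rw [hη₂]; positivity
  have hη₁D : η₁ * constD T = ε / 4 := by rw [hη₁, ← hD]; field_simp
  have hLη : η₂ ≤ L := by
    rw [hL, lipConst]
    have : 0 ≤ 1 / η₁ + momentNorm K M ^ 2 := by positivity
    linarith
  have hLpos : 0 < L := hη₂pos.trans_le hLη
  have hLeq : L = 4 * D / ε + a ^ 2 + ε * δ ^ 2 / (2 * C ^ 2) := by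
    rw [hL, lipConst, hη₁, hη₂, one_div_div]
  have hκ : L / η₂ = 8 * D * C ^ 2 / (ε ^ 2 * δ ^ 2) + 2 * a ^ 2 * C ^ 2 / (ε * δ ^ 2) + 1 := by
    rw [hLeq, hη₂]; field_simp; ring
  obtain ⟨p, hp⟩ := exists_forall_le_of_coercive hg.continuous hδpos (b := C + ε / 4) fun x => by
    have h1 := smoothedDualFn_le (ν := ν) (η₂ := η₂) hT hne hη₁pos.le x
    have h2 := dualFn_le_sub_norm hT hfeas hfin x
    have h3 : 0 ≤ η₂ / 2 * ‖x‖ ^ 2 := by positivity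
    rw [hC, hδ]
    linarith
  have hgrad : ∀ w, gradient F w = -g w := fun w => by
    have := hg.neg.hasGradientAt w
    simp only [neg_neg] at this
    exact this.gradient
  have hrate := hg.fast_gradient_rate hη₂pos hLη hp
    (fun k => (fastGradient ν T η₁ η₂ y₀ k).1) (fun k => (fastGradient ν T η₁ η₂ y₀ k).2) rfl
    (fun k => by
      change _ + (1 / L) • gradient F _ = _
      rw [hgrad, smul_neg, ← sub_eq_add_neg])
    (fun k => rfl) (numIter C D δ a ε)
  simp only [← hz] at hrate
  -- The start is no worse than `0`, where the smoothed value is at least `F(0) = 0`; the maximum is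
  -- at most `J* + ε / 4`.
  have hstart : -F y₀ - -F p ≤ C + ε / 4 := by
    have h1 := smoothedDualFn_le (ν := ν) (η₂ := η₂) hT hne hη₁pos.le p
    have h2 := dualFn_le_primalValue hT (primalValue_ne_top hfeas hfin) p
    have h3 := toReal_primalValue_le hfeas hfin
    have h4 := dualFn_sub_le_smoothedDualFn (ν := ν) (η₂ := η₂) hT hne hη₁pos.le 0
    have h5 : 0 ≤ η₂ / 2 * ‖p‖ ^ 2 := by positivity
    rw [dualFn_zero hT hne, norm_zero] at h4
    rw [← hC] at h3
    linarith
  have hN := Nat.le_ceil (max (iter₁ C D δ a ε) (iter₂ C D δ a ε))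
  have hN₁ : iter₁ C D δ a ε ≤ numIter C D δ a ε := (le_max_left _ _).trans hN
  have hN₂ : iter₂ C D δ a ε ≤ numIter C D δ a ε := (le_max_right _ _).trans hN
  rw [iter₁, ← hκ] at hN₁
  rw [iter₂, ← hκ, ← hLeq] at hN₂
  have hr : 0 < √(L / η₂) := Real.sqrt_pos.2 (div_pos hLpos hη₂pos)
  have hs : 0 < 2 - √3 := by
    have : √3 < 2 := (Real.sqrt_lt' two_pos).2 (by norm_num)
    linarith
  have hE₁ := exp_neg_div_le_of_mul_log_le (by positivity) hr hN₁
  have hE₂ := exp_neg_div_le_of_mul_log_le (by positivity) hr hN₂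
  have hgapE : -F z - -F p ≤
      2 * (C + ε / 4) * Real.exp (-(numIter C D δ a ε / √(L / η₂))) :=
    hrate.trans (by
      change 2 * (-F y₀ - -F p) * _ ≤ _
      gcongr)
  constructor
  · intro x
    have h1 : F x ≤ F p := neg_le_neg_iff.1 (hp x)
    -- The factor `2` before `√κ` squares the argument of the logarithm; its `10` becomes the `100`.
    have h2 : 2 * (C + ε / 4) * Real.exp (-(numIter C D δ a ε / √(L / η₂))) ≤ ε / 100 := by
      calc _ ≤ 2 * (C + ε / 4) * ((10 * (ε + 2 * C) / ε) ^ 2)⁻¹ := by gcongr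
        _ ≤ (ε + 2 * C) * ((10 * (ε + 2 * C) / ε) ^ 2)⁻¹ := by
            gcongr
            linarith
        _ = ε / 100 * (ε / (ε + 2 * C)) := by field_simp; norm_num
        _ ≤ ε / 100 * 1 := by
            gcongr
            rw [div_le_one (by positivity)]
            linarith
        _ = ε / 100 := mul_one _
    linarith
  -- The square root inside `N₂` is chosen to cancel the prefactor `2 * L * (2 * (C + ε / 2))`.
  · refine (sq_le_sq₀ (norm_nonneg _) (by positivity)).1 ?_
    calc ‖g z‖ ^ 2 ≤ 2 * L * (-F z - -F p) := hg.norm_sq_le hLpos hp z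
      _ ≤ 2 * L * (2 * (C + ε / 4) * ((C / (ε * δ * (2 - √3)) *
            √(4 * L * (C + ε / 2))) ^ 2)⁻¹) := by
          gcongr
          exact hgapE.trans (by gcongr)
      _ ≤ 2 * L * (2 * (C + ε / 2) * ((C / (ε * δ * (2 - √3)) *
            √(4 * L * (C + ε / 2))) ^ 2)⁻¹) := by
          gcongr
          linarith
      _ = (ε * δ * (2 - √3) / C) ^ 2 := by
          rw [mul_pow, Real.sq_sqrt (by positivity)]
          field_simp
          norm_num

end Accuracy

/-! ### Growth of the iteration count. -/

theorem numIter_isBigO {C D δ : ℝ} (a : ℝ) (hC : 0 < C) (hD : 0 < D) (hδ : 0 < δ) :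
    (fun ε : ℝ => (numIter C D δ a ε : ℝ)) =O[𝓝[>] 0] fun ε : ℝ => ε⁻¹ * Real.log (1 / ε) := by
  have hs : 0 < 2 - √3 := by
    have : √3 < 2 := (Real.sqrt_lt' two_pos).2 (by norm_num)
    linarith
  set c := 8 * D * C ^ 2 / δ ^ 2 + 2 * a ^ 2 * C ^ 2 / δ ^ 2 + 1 with hc
  set b₁ := 10 * (1 + 2 * C) with hb₁
  set b₂ := C / (δ * (2 - √3)) * √(4 * (4 * D + a ^ 2 + δ ^ 2 / (2 * C ^ 2)) * (C + 1)) with hb₂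
  have hcpos : 0 < c := by positivity
  have hb₁pos : 0 < b₁ := by positivity
  have hb₂pos : 0 < b₂ := by positivity
  have hlog : Tendsto (fun ε : ℝ => Real.log (1 / ε)) (𝓝[>] 0) atTop := by
    simp only [one_div]
    exact Real.tendsto_log_atTop.comp tendsto_inv_nhdsGT_zero
  -- Here `√κ ≤ √c / ε`, and the arguments of the logarithms are at most `b₁ / ε` and `b₂ / ε ^ 2`,
  -- so both logarithms are eventually at most `3 * l`. The `1` pays for the ceiling.
  refine IsBigO.of_bound (6 * √c + 1) ?_
  filter_upwards [Ioo_mem_nhdsGT (zero_lt_one' ℝ), hlog.eventually_ge_atTop 1,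
    hlog.eventually_ge_atTop (Real.log b₁), hlog.eventually_ge_atTop (Real.log b₂)]
    with ε ⟨hε, hε1⟩ hl1 hlb₁ hlb₂
  set l := Real.log (1 / ε) with hl
  have hinv : 1 ≤ ε⁻¹ := (one_le_inv₀ hε).2 hε1.le
  have hinv2 : ε⁻¹ ≤ ε⁻¹ ^ 2 := by nlinarith
  have hκ : √(8 * D * C ^ 2 / (ε ^ 2 * δ ^ 2) + 2 * a ^ 2 * C ^ 2 / (ε * δ ^ 2) + 1) ≤
      √c * ε⁻¹ := by
    rw [Real.sqrt_le_left (by positivity), mul_pow, Real.sq_sqrt hcpos.le]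
    have e : 8 * D * C ^ 2 / (ε ^ 2 * δ ^ 2) + 2 * a ^ 2 * C ^ 2 / (ε * δ ^ 2) + 1 =
        8 * D * C ^ 2 / δ ^ 2 * ε⁻¹ ^ 2 + 2 * a ^ 2 * C ^ 2 / δ ^ 2 * ε⁻¹ + 1 := by
      field_simp
    have h1 : 2 * a ^ 2 * C ^ 2 / δ ^ 2 * ε⁻¹ ≤ 2 * a ^ 2 * C ^ 2 / δ ^ 2 * ε⁻¹ ^ 2 := by gcongr
    rw [e, hc]
    linarith
  have hstep : ∀ A : ℝ, Real.log A ≤ 3 * l →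
      2 * √(8 * D * C ^ 2 / (ε ^ 2 * δ ^ 2) + 2 * a ^ 2 * C ^ 2 / (ε * δ ^ 2) + 1) * Real.log A ≤
        6 * √c * (ε⁻¹ * l) := by
    intro A hA
    calc _ ≤ 2 * √(8 * D * C ^ 2 / (ε ^ 2 * δ ^ 2) + 2 * a ^ 2 * C ^ 2 / (ε * δ ^ 2) + 1) *
          (3 * l) := by gcongr
      _ ≤ 2 * (√c * ε⁻¹) * (3 * l) := by gcongr
      _ = _ := by ring
  have h₁ : iter₁ C D δ a ε ≤ 6 * √c * (ε⁻¹ * l) := by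
    refine hstep _ ?_
    have h2 : 10 * (ε + 2 * C) / ε ≤ b₁ * (1 / ε) := by
      rw [hb₁, mul_one_div]
      gcongr
    have h3 := Real.log_le_log (by positivity) h2
    rw [Real.log_mul hb₁pos.ne' (by positivity), ← hl] at h3
    linarith
  have h₂ : iter₂ C D δ a ε ≤ 6 * √c * (ε⁻¹ * l) := by
    refine hstep _ ?_
    have h2 : √(4 * (4 * D / ε + a ^ 2 + ε * δ ^ 2 / (2 * C ^ 2)) * (C + ε / 2)) ≤
        √(4 * (4 * D + a ^ 2 + δ ^ 2 / (2 * C ^ 2)) * (C + 1)) * (1 / ε) := by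
      rw [Real.sqrt_le_left (by positivity), mul_pow, Real.sq_sqrt (by positivity), one_div]
      calc _ ≤ 4 * ((4 * D + a ^ 2 + δ ^ 2 / (2 * C ^ 2)) * ε⁻¹ ^ 2) * (C + 1) := by
            gcongr
            · have h3 : 4 * D / ε ≤ 4 * D * ε⁻¹ ^ 2 := by
                rw [div_eq_mul_inv]
                gcongr
              have h4 : a ^ 2 * 1 ≤ a ^ 2 * ε⁻¹ ^ 2 := by
                gcongr
                exact hinv.trans hinv2
              have h5 : ε * δ ^ 2 / (2 * C ^ 2) ≤ δ ^ 2 / (2 * C ^ 2) * ε⁻¹ ^ 2 := by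
                rw [mul_div_assoc, mul_comm]
                gcongr
                linarith
              linarith
            · linarith
        _ = _ := by ring
    have h3 : C / (ε * δ * (2 - √3)) *
        √(4 * (4 * D / ε + a ^ 2 + ε * δ ^ 2 / (2 * C ^ 2)) * (C + ε / 2)) ≤
        b₂ * (1 / ε) ^ 2 := by
      calc _ ≤ C / (ε * δ * (2 - √3)) *
            (√(4 * (4 * D + a ^ 2 + δ ^ 2 / (2 * C ^ 2)) * (C + 1)) * (1 / ε)) := by gcongr
        _ = _ := by rw [hb₂]; field_simp
    have h4 := Real.log_le_log (by positivity) h3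
    rw [Real.log_mul hb₂pos.ne' (by positivity), Real.log_pow, ← hl] at h4
    push_cast at h4
    linarith
  have hpos : 0 ≤ 6 * √c * (ε⁻¹ * l) := by positivity
  have hN : (numIter C D δ a ε : ℝ) ≤ 6 * √c * (ε⁻¹ * l) + 1 := by
    have h1 : numIter C D δ a ε ≤ ⌈6 * √c * (ε⁻¹ * l)⌉₊ := Nat.ceil_mono (max_le h₁ h₂)
    exact (Nat.cast_le.2 h1).trans (Nat.ceil_lt_add_one hpos).le
  have h1 : 1 ≤ ε⁻¹ * l := one_le_mul_of_one_le_of_one_le hinv hl1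
  rw [Real.norm_of_nonneg (Nat.cast_nonneg _), Real.norm_of_nonneg (by positivity)]
  linarith

end MaxEnt

/-! ### The convergence theorem. -/

open MaxEnt in
theorem mainTheorem12 {K : Set ℝ} (hK : IsCompact K) (ν : ProbabilityMeasure K) {M : ℕ}
    (y : Fin M → ℝ) (U : Fin M → Set ℝ)
    (hUcompact : ∀ i, IsCompact (U i)) (hUconvex : ∀ i, Convex ℝ (U i)) (hU0 : ∀ i, 0 ∈ U i)
    (T : Set (EuclideanSpace ℝ (Fin M))) (hT : T = constraintSet y U)
    (μ₀ : ProbabilityMeasure K)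
    (hfeas : moments M (μ₀ : Measure K) ∈ T)
    (C δ D a : ℝ) (hC : C = constC ν μ₀) (hδ : δ = constδ T μ₀) (hD : D = constD T)
    (ha : a = momentNorm K M)
    (hδpos : 0 < δ)
    (hfin : relEnt (μ₀ : Measure K) ν ≠ ∞) (hne : μ₀ ≠ ν) :
    (∀ ε : ℝ, 0 < ε →
      ∀ η₁ η₂ : ℝ, η₁ = ε / (4 * D) → η₂ = ε * δ ^ 2 / (2 * C ^ 2) →
      ∀ y₀ : EuclideanSpace ℝ (Fin M),
        smoothedDualFn ν T η₁ η₂ 0 ≤ smoothedDualFn ν T η₁ η₂ y₀ →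
      ∀ z : EuclideanSpace ℝ (Fin M), z = (fastGradient ν T η₁ η₂ y₀ (numIter C D δ a ε)).1 →
        (0 ≤ (primalValue ν T).toReal - dualFn ν T z ∧
          (primalValue ν T).toReal - dualFn ν T z ≤ ε) ∧
        IsProbabilityMeasure (gibbs ν z) ∧
        relEnt (gibbs ν z) ν ≠ ∞ ∧
        |(relEnt (gibbs ν z) ν).toReal - (primalValue ν T).toReal| ≤ 2 * (1 + 2 * √3) * ε ∧
        Metric.infDist (moments M (gibbs ν z)) T ≤ 2 * ε * δ / C) ∧
    (fun ε : ℝ => (numIter C D δ a ε : ℝ)) =O[𝓝[>] 0] fun ε : ℝ => ε⁻¹ * Real.log (1 / ε) := by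
  have : CompactSpace K := isCompact_iff_compactSpace.1 hK
  have hTc : IsCompact T := hT ▸ isCompact_constraintSet hUcompact
  have hTconv : Convex ℝ T := hT ▸ convex_constraintSet hUconvex
  have hTne : T.Nonempty := ⟨_, hfeas⟩
  have hCpos : 0 < C := hC ▸ toReal_relEnt_pos hfin (mt Subtype.ext hne)
  have hDpos : 0 < D := by
    rw [hD]
    rw [hδ] at hδpos
    exact constD_pos hTc hfeas hδpos
  refine ⟨fun ε hε η₁ η₂ hη₁ hη₂ y₀ hy₀ z hz => ?_, numIter_isBigO a hCpos hDpos hδpos⟩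
  have hη₁pos : 0 < η₁ := by rw [hη₁]; positivity
  have hη₁D : η₁ * constD T = ε / 4 := by rw [hη₁, ← hD]; field_simp
  obtain ⟨q, hqT, hqS, hq⟩ := exists_smoothedDualFn_gradient ν hTc hTconv hTne hη₁pos η₂
  rw [ha] at hz
  obtain ⟨hgap, hgrad⟩ := fastGradient_gap hTc hfeas hfin hC hδ hD hCpos hδpos hDpos hε hη₁ hη₂ hq
    hy₀ hz
  obtain ⟨h1, h2, h3⟩ := accuracy_of_small_gap hTc hTconv hfeas hfin hC hδ hCpos hδpos hε
    hη₁pos.le hη₁D hη₂ (hqT z) (hqS z) rfl hgap hgrad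
  exact ⟨⟨sub_nonneg.2 (dualFn_le_primalValue hTc (primalValue_ne_top hfeas hfin) z), h1⟩,
    isProbabilityMeasure_gibbs ν z, (relEnt_gibbs ν z).1, h2, h3⟩
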